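/- Let $k$ be a field, let $G$ be an abelian group (written additively), let $A=\bigoplus_{\sigma\in G}A_\sigma$ be a $G$-graded $k$-algebra (associative, unital, with $A_\sigma A_\tau\subseteq A_{\sigma+\tau}$), and let $d\ge 0$ be an integer. Let $A^e=A\otimes_k A^{\mathrm{op}}$, graded by letting $(A^e)_\gamma$ be the span of all $a\otimes b^{\mathrm{op}}$ with $a\in A_\sigma$, $b\in A_\tau$, $\sigma+\tau=\gamma$. All $(A,A)$-bimodules are $k$-central and are identified with left $A^e$-modules through $(a\otimes b^{\mathrm{op}})\cdot m=amb$; a right $A^e$-module is regarded as an $(A,A)$-bimodule through $amb=m\cdot(b\otimes a^{\mathrm{op}})$. Graded $(A,A)$-bimodules are $G$-graded left $A^e$-modules, and morphisms of graded modules preserve degrees. *Ungraded notions.* $A$ is homologically smooth if it has a finite-length resolution by finitely generated projective left $A^e$-modules. A bimodule $U$ is invertible if there is a bimodule $V$ with $U\otimes_A V\cong V\otimes_A U\cong A$ as bimodules. $A$ is twisted Calabi–Yau of dimension $d$ if $A$ is homologically smooth and there is an invertible bimodule $U$ such that $\mathrm{Ext}^i_{A^e}(A,A^e)=0$ for all $i\ne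 d$ and $\mathrm{Ext}^d_{A^e}(A,A^e)\cong U$ as bimodules, where the Ext groups are right $A^e$-modules through right multiplication on the second argument $A^e$. *Graded notions.* For a graded left $A^e$-module $M$ let $\underline{\mathrm{Hom}}_{A^e}(M,A^e)=\bigoplus_{\tau\in G}\{f\in\mathrm{Hom}_{A^e}(M,A^e): f(M_\sigma)\subseteq (A^e)_{\sigma+\tau}\text{ for all }\sigma\}$, and let $\underline{\mathrm{Ext}}^i_{A^e}(M,A^e)$ be its derived functors, i.e. the $i$-th cohomology of $\underline{\mathrm{Hom}}_{A^e}(P_\bullet,A^e)$ for a projective resolution $P_\bullet$ of $M$ in the category of graded left $A^e$-modules, with its induced grading and right $A^e$-module structure. $A$ is $G$-graded homologically smooth if it has a finite-length resolution by finitely generated projective objects in the category of graded left $A^e$-modules. A graded bimodule $U$ is $G$-graded invertible if there is a graded bimodule $V$ with $U\otimes_A V\cong V\otimes_A U\cong A$ as graded bimodules, where $(U\otimes_A V)_\gamma$ is spanned by the $u\otimes v$ with $u\in U_\sigma$, $v\in V_\tau$, $\sigma+\tau=\gamma$. $A$ is $G$-graded twisted Calabi–Yau of dimension $d$ if $A$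 is $G$-graded homologically smooth and there is a $G$-graded invertible bimodule $U$ such that $\underline{\mathrm{Ext}}^i_{A^e}(A,A^e)=0$ for all $i\neq d$ and $\underline{\mathrm{Ext}}^d_{A^e}(A,A^e)\cong U$ as graded bimodules. **Theorem.** $A$ is twisted Calabi–Yau of dimension $d$ if and only if $A$ is $G$-graded twisted Calabi–Yau of dimension $d$. -/

import Mathlib

open scoped TensorProduct DirectSum

universe u v w

noncomputable section

namespace GradedCY

section Subquotient

variable {S W : Type*} [Ring S] [AddCommGroup W] [Module S W]

/-- The subquotient `Z / (B ∩ Z)` of a module. -/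
def Subquotient (Z B : Submodule S W) : Type _ := Z ⧸ B.submoduleOf Z

instance (Z B : Submodule S W) : AddCommGroup (Subquotient Z B) :=
  inferInstanceAs (AddCommGroup (Z ⧸ B.submoduleOf Z))

instance (Z B : Submodule S W) : Module S (Subquotient Z B) :=
  inferInstanceAs (Module S (Z ⧸ B.submoduleOf Z))

/-- The class of an element of `Z`. -/
def Subquotient.mk (Z B : Submodule S W) : Z →ₗ[S] Subquotient Z B := (B.submoduleOf Z).mkQ

end Subquotient

/-! ### Graded left modules over a graded algebra -/

section GradedModules

variable {k : Type u} [Field k] {G : Type w} [AddCommGroup G] [DecidableEq G]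
variable {R : Type v} [Ring R] [Algebra k R]

/-- A family of subgroups that spans, and that admits projections killing the other members,
is a direct sum decomposition. -/
theorem isInternal_of_proj {M : Type v} [AddCommGroup M] (deg : G → AddSubgroup M)
    (htop : ⨆ i, deg i = ⊤) (π : G → M →+ M) (hπ : ∀ i, ∀ x ∈ deg i, π i x = x)
    (hπ' : ∀ i j, j ≠ i → ∀ x ∈ deg j, π i x = 0) : DirectSum.IsInternal deg := by
  have key : ∀ (i : G) (f : ⨁ i, deg i),
      π i (DirectSum.coeAddMonoidHom deg f) = ((f i : deg i) : M) := by
    intro i f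
    induction f using DirectSum.induction_on with
    | zero => simp
    | of j x =>
      rw [DirectSum.coeAddMonoidHom_of]
      by_cases h : j = i
      · subst h
        rw [hπ _ _ x.2, DirectSum.of_eq_same]
      · rw [hπ' i j h _ x.2, DirectSum.of_eq_of_ne _ _ _ (Ne.symm h)]
        rfl
    | add f g hf hg => simp [hf, hg]
  constructor
  · rw [injective_iff_map_eq_zero]
    intro f hf
    ext i
    rw [← key i f, hf]
    simp
  · intro x
    have hx : x ∈ ⨆ i, deg i := htop ▸ AddSubgroup.mem_top x
    induction hx using AddSubgroup.iSup_induction' with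
    | hp i x hx => exact ⟨DirectSum.of _ i ⟨x, hx⟩, by simp⟩
    | h1 => exact ⟨0, by simp⟩
    | hadd x y _ _ h1 h2 =>
      obtain ⟨a, rfl⟩ := h1
      obtain ⟨b, rfl⟩ := h2
      exact ⟨a + b, by simp⟩

/-- A `G`-graded left module over the graded algebra `(R, 𝓡)`. -/
structure GrMod (𝓡 : G → Submodule k R) where
  carrier : Type v
  [addCommGroup : AddCommGroup carrier]
  [module : Module R carrier]
  deg : G → AddSubgroup carrier
  isInternal : DirectSum.IsInternal deg
  smul_mem : ∀ {i j : G} {r : R} {m : carrier}, r ∈ 𝓡 i → m ∈ deg j → r • m ∈ deg (i + j)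

attribute [instance] GrMod.addCommGroup GrMod.module

variable {𝓡 : G → Submodule k R}

/-- A homomorphism of graded modules (of degree zero). -/
def IsGrHom (M N : GrMod 𝓡) (f : M.carrier →ₗ[R] N.carrier) : Prop :=
  ∀ i, ∀ m ∈ M.deg i, f m ∈ N.deg i

/-- Projective objects of the category of graded modules. -/
def IsGrProjective (P : GrMod 𝓡) : Prop :=
  ∀ (X Y : GrMod 𝓡) (q : X.carrier →ₗ[R] Y.carrier) (g : P.carrier →ₗ[R] Y.carrier),
    IsGrHom X Y q → Function.Surjective q → IsGrHom P Y g →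
      ∃ h : P.carrier →ₗ[R] X.carrier, IsGrHom P X h ∧ q ∘ₗ h = g

/-- Projective resolutions in the category of graded modules. -/
structure GrProjRes (M : GrMod 𝓡) where
  X : ℕ → GrMod 𝓡
  d : ∀ n, (X (n + 1)).carrier →ₗ[R] (X n).carrier
  ε : (X 0).carrier →ₗ[R] M.carrier
  d_graded : ∀ n, IsGrHom (X (n + 1)) (X n) (d n)
  ε_graded : IsGrHom (X 0) M ε
  projective : ∀ n, IsGrProjective (X n)
  ε_surjective : Function.Surjective ε
  exact_zero : Function.Exact (d 0) ε
  exact_succ : ∀ n, Function.Exact (d (n + 1)) (d n)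

/-- The projection of a graded module onto its component of degree `i`. -/
def GrMod.proj (M : GrMod 𝓡) (i : G) : M.carrier →+ M.carrier :=
  letI := M.isInternal.chooseDecomposition
  (M.deg i).subtype.comp
    ((DFinsupp.evalAddMonoidHom i).comp (DirectSum.decomposeAddEquiv M.deg).toAddMonoidHom)

theorem GrMod.proj_mem (M : GrMod 𝓡) (i : G) (x : M.carrier) : M.proj i x ∈ M.deg i :=
  SetLike.coe_mem _

theorem GrMod.proj_same (M : GrMod 𝓡) (i : G) (x : M.carrier) (hx : x ∈ M.deg i) :
    M.proj i x = x :=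
  letI := M.isInternal.chooseDecomposition
  DirectSum.decompose_of_mem_same M.deg hx

theorem GrMod.proj_ne (M : GrMod 𝓡) (i j : G) (h : j ≠ i) (x : M.carrier) (hx : x ∈ M.deg j) :
    M.proj i x = 0 :=
  letI := M.isInternal.chooseDecomposition
  DirectSum.decompose_of_mem_ne M.deg hx h

theorem GrMod.iSup_deg (M : GrMod 𝓡) : ⨆ i, M.deg i = ⊤ := by
  rw [eq_top_iff]
  intro x _
  obtain ⟨f, rfl⟩ := M.isInternal.2 x
  induction f using DirectSum.induction_on with
  | zero => simp
  | of j x =>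
    rw [DirectSum.coeAddMonoidHom_of]
    exact AddSubgroup.mem_iSup_of_mem j x.2
  | add f g hf hg =>
    rw [map_add]
    exact add_mem (hf trivial) (hg trivial)

theorem GrMod.exists_sum_proj (M : GrMod 𝓡) (x : M.carrier) :
    ∃ s : Finset G, x = ∑ i ∈ s, M.proj i x := by
  classical
  let _ := M.isInternal.chooseDecomposition
  exact ⟨_, (DirectSum.sum_support_decompose M.deg x).symm⟩

/-- Graded homomorphisms commute with the projections. -/
theorem IsGrHom.map_proj {M N : GrMod 𝓡} {f : M.carrier →ₗ[R] N.carrier} (hf : IsGrHom M N f)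
    (i : G) (x : M.carrier) : f (M.proj i x) = N.proj i (f x) := by
  have hx : x ∈ ⨆ i, M.deg i := M.iSup_deg ▸ AddSubgroup.mem_top x
  induction hx using AddSubgroup.iSup_induction' with
  | hp j x hx =>
    by_cases h : j = i
    · subst h
      rw [M.proj_same _ _ hx, N.proj_same _ _ (hf _ _ hx)]
    · rw [M.proj_ne _ _ h _ hx, N.proj_ne _ _ h _ (hf _ _ hx), map_zero]
  | h1 => simp
  | hadd x y _ _ h1 h2 => simp [h1, h2]

/-- The kernel of a homomorphism of graded modules. -/
abbrev GrMod.ker {M N : GrMod 𝓡} (f : M.carrier →ₗ[R] N.carrier) (hf : IsGrHom M N f) :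
    GrMod 𝓡 where
  carrier := LinearMap.ker f
  deg i := (M.deg i).comap (LinearMap.ker f).subtype.toAddMonoidHom
  isInternal := by
    have hker : ∀ i (x : LinearMap.ker f), M.proj i x.1 ∈ LinearMap.ker f := fun i x => by
      rw [LinearMap.mem_ker, hf.map_proj, LinearMap.mem_ker.1 x.2, map_zero]
    refine isInternal_of_proj _ ?_
      (fun i => AddMonoidHom.mk' (fun x => ⟨M.proj i x.1, hker i x⟩)
        (fun x y => Subtype.ext (by simp))) ?_ ?_
    · rw [eq_top_iff]
      intro x _
      obtain ⟨s, hs⟩ := M.exists_sum_proj x.1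
      have : x = ∑ i ∈ s, (⟨M.proj i x.1, hker i x⟩ : LinearMap.ker f) :=
        Subtype.ext (by simpa using hs)
      rw [this]
      exact sum_mem fun i _ => AddSubgroup.mem_iSup_of_mem i (M.proj_mem i x.1)
    · exact fun i x hx => Subtype.ext (M.proj_same i x.1 hx)
    · exact fun i j h x hx => Subtype.ext (M.proj_ne i j h x.1 hx)
  smul_mem hr hm := M.smul_mem hr hm

section Free

variable [GradedAlgebra 𝓡]

/-- The graded free module on homogeneous generators `x : ι` of degrees `e x`. -/
abbrev GrMod.free (𝓡 : G → Submodule k R) [GradedAlgebra 𝓡] (ι : Type v) (e : ι → G) :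
    GrMod 𝓡 where
  carrier := Π₀ _ : ι, R
  deg γ :=
    { carrier := {f | ∀ x, f x ∈ 𝓡 (γ - e x)}
      zero_mem' := fun x => by simp
      add_mem' := fun hf hg x => by simpa using add_mem (hf x) (hg x)
      neg_mem' := fun hf x => by simpa using hf x }
  isInternal := by
    classical
    refine isInternal_of_proj _ ?_
      (fun γ => DFinsupp.mapRange.addMonoidHom fun x => GradedRing.proj 𝓡 (γ - e x)) ?_ ?_
    · rw [eq_top_iff]
      intro f _
      induction f using DFinsupp.induction with
      | h0 => exact zero_mem _
      | ha x r f _ _ ih =>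
        refine add_mem ?_ (ih trivial)
        rw [← DirectSum.sum_support_decompose 𝓡 r, ← DFinsupp.singleAddHom_apply, map_sum]
        refine sum_mem fun i _ => AddSubgroup.mem_iSup_of_mem (i + e x) fun y => ?_
        by_cases h : x = y
        · subst h
          simp
        · simp [DFinsupp.single_eq_of_ne (Ne.symm h)]
    · intro i f hf
      ext x
      simpa using DirectSum.decompose_of_mem_same 𝓡 (hf x)
    · intro i j h f hf
      ext x
      simpa using DirectSum.decompose_of_mem_ne 𝓡 (hf x) (fun h' => h (by simpa using h'))
  smul_mem := by
    intro i j r f hr hf x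
    have := SetLike.GradedMul.mul_mem hr (hf x)
    rw [← add_sub_assoc] at this
    simpa using this

theorem GrMod.free_isGrProjective (ι : Type v) (e : ι → G) :
    IsGrProjective (GrMod.free 𝓡 ι e) := by
  classical
  intro X Y q g hq hs hg
  have hgen : ∀ x : ι, ∃ c ∈ X.deg (e x), q c = g (DFinsupp.single x (1 : R)) := by
    intro x
    have h1 : g (DFinsupp.single x (1 : R)) ∈ Y.deg (e x) := by
      refine hg (e x) _ fun y => ?_
      by_cases h : x = y
      · subst h
        simpa using SetLike.GradedOne.one_mem (A := 𝓡)
      · simp [DFinsupp.single_eq_of_ne (Ne.symm h)]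
    obtain ⟨c, hc⟩ := hs (g (DFinsupp.single x (1 : R)))
    refine ⟨X.proj (e x) c, X.proj_mem _ _, ?_⟩
    rw [hq.map_proj, hc, Y.proj_same _ _ h1]
  choose c hc hqc using hgen
  refine ⟨DFinsupp.lsum ℕ fun x => LinearMap.toSpanSingleton R X.carrier (c x), ?_, ?_⟩
  · intro γ f hf
    have : (DFinsupp.lsum ℕ fun x => LinearMap.toSpanSingleton R X.carrier (c x)) f
        = f.sum fun x r => r • c x := by
      simp [DFinsupp.sumAddHom_apply]
      rfl
    rw [this]
    refine sum_mem fun x _ => ?_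
    have := X.smul_mem (hf x) (hc x)
    rwa [sub_add_cancel] at this
  · refine DFinsupp.lhom_ext' fun x => LinearMap.ext_ring ?_
    simp [hqc]

/-- Every graded module is a graded quotient of a graded free module. -/
theorem GrMod.exists_cover (M : GrMod 𝓡) :
    ∃ (F : GrMod 𝓡) (p : F.carrier →ₗ[R] M.carrier),
      IsGrProjective F ∧ IsGrHom F M p ∧ Function.Surjective p := by
  classical
  let ι : Type v := {m : M.carrier // ∃ i, m ∈ M.deg i}
  let e : ι → G := fun m => m.2.choose
  let p : (Π₀ _ : ι, R) →ₗ[R] M.carrier :=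
    DFinsupp.lsum ℕ fun m : ι => LinearMap.toSpanSingleton R M.carrier m.1
  refine ⟨GrMod.free 𝓡 ι e, p, GrMod.free_isGrProjective ι e, ?_, ?_⟩
  · intro γ f hf
    have : p f = f.sum fun x r => r • x.1 := by
      simp [p, DFinsupp.sumAddHom_apply]
      rfl
    rw [this]
    refine sum_mem fun x _ => ?_
    have := M.smul_mem (hf x) x.2.choose_spec
    rwa [sub_add_cancel] at this
  · intro x
    have hx : x ∈ ⨆ i, M.deg i := M.iSup_deg ▸ AddSubgroup.mem_top x
    induction hx using AddSubgroup.iSup_induction' with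
    | hp j x hx =>
      exact ⟨DFinsupp.single (⟨x, j, hx⟩ : ι) (1 : R), by simp [p]⟩
    | h1 => exact ⟨0, map_zero _⟩
    | hadd x y _ _ h1 h2 =>
      obtain ⟨a, rfl⟩ := h1
      obtain ⟨b, rfl⟩ := h2
      exact ⟨a + b, map_add _ _ _⟩

end Free

section Resolutions

variable [GradedAlgebra 𝓡]

/-- A chosen graded projective cover of `M`. -/
def GrMod.cov (M : GrMod 𝓡) : GrMod 𝓡 := M.exists_cover.choose

/-- The projection of the chosen cover. -/
def GrMod.covMap (M : GrMod 𝓡) : M.cov.carrier →ₗ[R] M.carrier := M.exists_cover.choose_spec.choose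

theorem GrMod.covMap_spec (M : GrMod 𝓡) :
    IsGrProjective M.cov ∧ IsGrHom M.cov M M.covMap ∧ Function.Surjective M.covMap :=
  M.exists_cover.choose_spec.choose_spec

/-- The iterated syzygies of `M`. -/
def GrMod.syz (M : GrMod 𝓡) : ℕ → GrMod 𝓡
  | 0 => M
  | n + 1 => GrMod.ker (M.syz n).covMap (M.syz n).covMap_spec.2.1

/-- The inclusion of a syzygy into the preceding cover. -/
def GrMod.syzIncl (M : GrMod 𝓡) (n : ℕ) : (M.syz (n + 1)).carrier →ₗ[R] (M.syz n).cov.carrier :=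
  (LinearMap.ker (M.syz n).covMap).subtype

theorem GrMod.exact_syz (M : GrMod 𝓡) (n : ℕ) :
    Function.Exact (M.syzIncl n ∘ₗ (M.syz (n + 1)).covMap) (M.syz n).covMap := by
  intro y
  constructor
  · intro hy
    obtain ⟨z, hz⟩ := (M.syz (n + 1)).covMap_spec.2.2 ⟨y, hy⟩
    exact ⟨z, congrArg Subtype.val hz⟩
  · rintro ⟨z, rfl⟩
    exact ((M.syz (n + 1)).covMap z).2

/-- Graded projective resolutions exist. -/
theorem GrProjRes.exists (M : GrMod 𝓡) : Nonempty (GrProjRes M) :=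
  ⟨{ X := fun n => (M.syz n).cov
     d := fun n => M.syzIncl n ∘ₗ (M.syz (n + 1)).covMap
     ε := M.covMap
     d_graded := fun n i m hm => (M.syz (n + 1)).covMap_spec.2.1 i m hm
     ε_graded := M.covMap_spec.2.1
     projective := fun n => (M.syz n).covMap_spec.1
     ε_surjective := M.covMap_spec.2.2
     exact_zero := M.exact_syz 0
     exact_succ := fun n y => by
       rw [← M.exact_syz (n + 1) y]
       exact ⟨fun h => Subtype.ext h, fun h => congrArg Subtype.val h⟩ }⟩

end Resolutions

/-! ### The total `HOM` into the algebra and its derived functors -/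

/-- Homomorphisms `f : M → R` of degree `τ`, that is, `f (M_σ) ⊆ R_(σ + τ)` for all `σ`. -/
def homDeg (M : GrMod 𝓡) (τ : G) : AddSubgroup (M.carrier →ₗ[R] R) where
  carrier := {f | ∀ σ, ∀ m ∈ M.deg σ, f m ∈ 𝓡 (σ + τ)}
  zero_mem' := fun σ m _ => by simp
  add_mem' := fun hf hg σ m hm => by simpa using add_mem (hf σ m hm) (hg σ m hm)
  neg_mem' := fun hf σ m hm => by simpa using hf σ m hm

variable [GradedAlgebra 𝓡]

/-- The total group `HOM_R(M, R)`, the sum of the `homDeg M τ` inside `Hom_R(M, R)`. It is a right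
`R`-module through `(f · r)(m) = f(m) r`. -/
def totalHom (M : GrMod 𝓡) : Submodule Rᵐᵒᵖ (M.carrier →ₗ[R] R) where
  toAddSubmonoid := (⨆ τ, homDeg M τ).toAddSubmonoid
  smul_mem' := by
    classical
    intro r f hf
    change f ∈ ⨆ τ, homDeg M τ at hf
    change r • f ∈ ⨆ τ, homDeg M τ
    induction hf using AddSubgroup.iSup_induction' with
    | hp τ f hf =>
      have hr : r • f = ∑ i ∈ (DirectSum.decompose 𝓡 r.unop).support,
          MulOpposite.op (DirectSum.decompose 𝓡 r.unop i : R) • f := by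
        rw [← Finset.sum_smul, ← Finset.op_sum, DirectSum.sum_support_decompose 𝓡 r.unop,
          MulOpposite.op_unop]
      rw [hr]
      refine sum_mem fun i _ => AddSubgroup.mem_iSup_of_mem (τ + i) fun σ m hm => ?_
      have := SetLike.GradedMul.mul_mem (hf σ m hm) (DirectSum.decompose 𝓡 r.unop i).2
      rw [add_assoc] at this
      simpa using this
    | h1 => simp
    | hadd f g _ _ h1 h2 =>
      rw [smul_add]
      exact add_mem h1 h2

/-- Precomposition with a homomorphism of left modules, as a map of right `R`-modules. -/
def precomp {X Y : Type v} [AddCommGroup X] [Module R X] [AddCommGroup Y] [Module R Y]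
    (d : X →ₗ[R] Y) : (Y →ₗ[R] R) →ₗ[Rᵐᵒᵖ] (X →ₗ[R] R) where
  toFun f := f ∘ₗ d
  map_add' _ _ := rfl
  map_smul' _ _ := rfl

namespace GrProjRes

variable {M : GrMod 𝓡} (P : GrProjRes M)

/-- Cocycles of the complex `HOM_R(P_•, R)`. -/
def cocycles (n : ℕ) : Submodule Rᵐᵒᵖ ((P.X n).carrier →ₗ[R] R) :=
  totalHom (P.X n) ⊓ LinearMap.ker (precomp (P.d n))

/-- Coboundaries of the complex `HOM_R(P_•, R)`. -/
def coboundaries : ∀ n : ℕ, Submodule Rᵐᵒᵖ ((P.X n).carrier →ₗ[R] R)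
  | 0 => ⊥
  | n + 1 => (totalHom (P.X n)).map (precomp (P.d n))

/-- The cohomology of the complex `HOM_R(P_•, R)`, a right `R`-module. -/
abbrev cohomology (n : ℕ) : Type v := Subquotient (P.cocycles n) (P.coboundaries n)

/-- The degree `τ` component of the cohomology: the classes of the cocycles of degree `τ`. -/
def cohomologyDeg (n : ℕ) (τ : G) : AddSubgroup (P.cohomology n) where
  carrier := {x | ∃ z : P.cocycles n, z.1 ∈ homDeg (P.X n) τ ∧
    Subquotient.mk (P.cocycles n) (P.coboundaries n) z = x}
  zero_mem' := ⟨0, zero_mem _, map_zero _⟩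
  add_mem' := by
    rintro _ _ ⟨y, hy, rfl⟩ ⟨z, hz, rfl⟩
    exact ⟨y + z, add_mem hy hz, map_add _ _ _⟩
  neg_mem' := by
    rintro _ ⟨y, hy, rfl⟩
    refine ⟨-y, neg_mem hy, eq_neg_of_add_eq_zero_left ?_⟩
    have h : -y + y = 0 := Subtype.ext (neg_add_cancel y.1)
    rw [← map_add, h, map_zero]

end GrProjRes

/-- The total graded `Ext^n_R(M, R)`, derived from `HOM_R(-, R)` through a chosen projective
resolution of `M` in the category of graded modules. It is a right `R`-module. -/
abbrev grExt (M : GrMod 𝓡) (n : ℕ) : Type v :=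
  (Classical.choice (GrProjRes.exists M)).cohomology n

/-- The grading of the total graded `Ext`. -/
def grExtDeg (M : GrMod 𝓡) (n : ℕ) (τ : G) : AddSubgroup (grExt M n) :=
  (Classical.choice (GrProjRes.exists M)).cohomologyDeg n τ

end GradedModules

/-! ### Ungraded `Ext^n_R(M, R)` as a right `R`-module -/

section Ext

open CategoryTheory

variable {R : Type v} [Ring R]

/-- Right multiplication by `r`, an endomorphism of the left module `R`. -/
def rightMul (r : R) : ModuleCat.of R R ⟶ ModuleCat.of R R :=
  ModuleCat.ofHom (LinearMap.toSpanSingleton R R r)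

/-- Mathlib's `Ext^n_R(M, R)` in the category of left `R`-modules. -/
abbrev ExtR (M : ModuleCat.{v} R) (n : ℕ) : Type v := Abelian.Ext M (ModuleCat.of R R) n

/-- The right `R`-module structure of `Ext^n_R(M, R)`, induced by right multiplications on the
second argument. -/
instance (M : ModuleCat.{v} R) (n : ℕ) : Module Rᵐᵒᵖ (ExtR M n) where
  smul r x := Abelian.Ext.comp (x : Abelian.Ext M (ModuleCat.of R R) n)
    (Abelian.Ext.mk₀ (rightMul r.unop)) (add_zero n)
  one_smul x := by
    have : rightMul (1 : R) = 𝟙 _ := by ext; simp [rightMul]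
    change Abelian.Ext.comp _ (Abelian.Ext.mk₀ (rightMul (1 : R))) _ = _
    rw [this, Abelian.Ext.comp_mk₀_id]
  mul_smul r s x := by
    have : rightMul (s.unop * r.unop) = rightMul s.unop ≫ rightMul r.unop := by
      ext; simp [rightMul]
    change Abelian.Ext.comp _ (Abelian.Ext.mk₀ (rightMul (s.unop * r.unop))) _
      = Abelian.Ext.comp (Abelian.Ext.comp _ _ _) _ _
    rw [this, Abelian.Ext.comp_assoc_of_third_deg_zero, Abelian.Ext.mk₀_comp_mk₀]
  smul_zero r := Abelian.Ext.zero_comp _ _ _ _ _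
  smul_add r x y := Abelian.Ext.add_comp _ _ _ _
  add_smul r s x := by
    have : rightMul (r.unop + s.unop) = rightMul r.unop + rightMul s.unop := by
      ext; simp [rightMul]
    change Abelian.Ext.comp _ (Abelian.Ext.mk₀ (rightMul (r.unop + s.unop))) _
      = Abelian.Ext.comp _ _ _ + Abelian.Ext.comp _ _ _
    rw [this, Abelian.Ext.mk₀_add, Abelian.Ext.comp_add]
  zero_smul x := by
    have : rightMul (0 : R) = 0 := by ext; simp [rightMul]
    change Abelian.Ext.comp _ (Abelian.Ext.mk₀ (rightMul (0 : R))) _ = _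
    rw [this, Abelian.Ext.mk₀_zero, Abelian.Ext.comp_zero]

end Ext

/-! ### Bimodules as modules over the enveloping algebra -/

section Bimodules

open CategoryTheory MulOpposite

variable (k : Type u) [Field k] (A : Type v) [Ring A] [Algebra k A]

/-- The enveloping algebra. A `k`-central `(A, A)`-bimodule is the same as a left module over it,
with `a · m · b = (a ⊗ op b) • m`. -/
abbrev Env : Type v := A ⊗[k] Aᵐᵒᵖ

/-- `A` as a bimodule over itself. -/
instance : Module (Env k A) A := TensorProduct.Algebra.module

theorem env_smul (a b x : A) : (a ⊗ₜ[k] op b : Env k A) • x = a * x * b := by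
  rw [TensorProduct.Algebra.smul_def]
  simp [mul_assoc]

variable {k A}

open scoped ModuleCat.Algebra

/-- The action of an element of the enveloping algebra, as a `k`-linear map. -/
abbrev act (U : ModuleCat.{v} (Env k A)) : Env k A →ₐ[k] Module.End k U :=
  Algebra.lsmul k k U

/-- The relations `u a ⊗ v = u ⊗ a v`. -/
def tensorRel (U V : ModuleCat.{v} (Env k A)) : Submodule k (U ⊗[k] V) :=
  Submodule.span k {x | ∃ (u : U) (a : A) (v : V),
    x = ((1 ⊗ₜ op a : Env k A) • u) ⊗ₜ[k] v - u ⊗ₜ[k] ((a ⊗ₜ 1 : Env k A) • v)}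

/-- The tensor product `U ⊗_A V` of two bimodules. -/
def tensorA (U V : ModuleCat.{v} (Env k A)) : Type v := (U ⊗[k] V) ⧸ tensorRel U V

instance (U V : ModuleCat.{v} (Env k A)) : AddCommGroup (tensorA U V) :=
  inferInstanceAs (AddCommGroup ((U ⊗[k] V) ⧸ tensorRel U V))

instance (U V : ModuleCat.{v} (Env k A)) : Module k (tensorA U V) :=
  inferInstanceAs (Module k ((U ⊗[k] V) ⧸ tensorRel U V))

/-- The class of `u ⊗ v` in `U ⊗_A V`. -/
def tmulA {U V : ModuleCat.{v} (Env k A)} (u : U) (v : V) : tensorA U V :=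
  (tensorRel U V).mkQ (u ⊗ₜ[k] v)

theorem tensorA_hom_ext {U V : ModuleCat.{v} (Env k A)} {f g : Module.End k (tensorA U V)}
    (h : ∀ (u : U) (v : V), f (tmulA u v) = g (tmulA u v)) : f = g := by
  refine Submodule.linearMap_qext (tensorRel U V) (TensorProduct.ext' h)

/-- Left multiplication by `a` on `U ⊗_A V`. -/
def tensorLeft (U V : ModuleCat.{v} (Env k A)) (a : A) : Module.End k (tensorA U V) :=
  (tensorRel U V).mapQ (tensorRel U V)
    (TensorProduct.map (act U (a ⊗ₜ 1)) LinearMap.id) (by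
      refine Submodule.span_le.2 ?_
      rintro _ ⟨u, b, v, rfl⟩
      refine Submodule.subset_span ⟨(a ⊗ₜ 1 : Env k A) • u, b, v, ?_⟩
      simp [smul_smul])

/-- Right multiplication by `b` on `U ⊗_A V`. -/
def tensorRight (U V : ModuleCat.{v} (Env k A)) (b : Aᵐᵒᵖ) : Module.End k (tensorA U V) :=
  (tensorRel U V).mapQ (tensorRel U V)
    (TensorProduct.map LinearMap.id (act V (1 ⊗ₜ b))) (by
      refine Submodule.span_le.2 ?_
      rintro _ ⟨u, a, v, rfl⟩
      refine Submodule.subset_span ⟨u, a, (1 ⊗ₜ b : Env k A) • v, ?_⟩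
      simp [smul_smul])

theorem tensorLeft_tmulA {U V : ModuleCat.{v} (Env k A)} (a : A) (u : U) (v : V) :
    tensorLeft U V a (tmulA u v) = tmulA ((a ⊗ₜ 1 : Env k A) • u) v := rfl

theorem tensorRight_tmulA {U V : ModuleCat.{v} (Env k A)} (b : Aᵐᵒᵖ) (u : U) (v : V) :
    tensorRight U V b (tmulA u v) = tmulA u ((1 ⊗ₜ b : Env k A) • v) := rfl

theorem tmulA_add_left {U V : ModuleCat.{v} (Env k A)} (u u' : U) (v : V) :
    tmulA (u + u') v = tmulA u v + tmulA u' v := by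
  unfold tmulA
  rw [TensorProduct.add_tmul, map_add]
  rfl

theorem tmulA_add_right {U V : ModuleCat.{v} (Env k A)} (u : U) (v v' : V) :
    tmulA u (v + v') = tmulA u v + tmulA u v' := by
  unfold tmulA
  rw [TensorProduct.tmul_add, map_add]
  rfl

theorem tmulA_smul_left {U V : ModuleCat.{v} (Env k A)} (c : k) (u : U) (v : V) :
    tmulA (c • u) v = c • tmulA u v := by
  unfold tmulA
  rw [← TensorProduct.smul_tmul', map_smul]
  rfl

theorem tmulA_smul_right {U V : ModuleCat.{v} (Env k A)} (c : k) (u : U) (v : V) :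
    tmulA u (c • v) = c • tmulA u v := by
  unfold tmulA
  rw [TensorProduct.tmul_smul, map_smul]
  rfl

/-- The action of the enveloping algebra on `U ⊗_A V`. -/
def tensorAct (U V : ModuleCat.{v} (Env k A)) : Env k A →ₐ[k] Module.End k (tensorA U V) :=
  Algebra.TensorProduct.lift
    (AlgHom.ofLinearMap
      { toFun := tensorLeft U V
        map_add' := fun a b => tensorA_hom_ext fun u v => by
          simp [tensorLeft_tmulA, TensorProduct.add_tmul, add_smul, tmulA_add_left]
        map_smul' := fun c a => tensorA_hom_ext fun u v => by
          simp [tensorLeft_tmulA, ← TensorProduct.smul_tmul', smul_assoc, tmulA_smul_left] }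
      (tensorA_hom_ext fun u v => by
        simp [tensorLeft_tmulA, ← Algebra.TensorProduct.one_def])
      (fun a b => tensorA_hom_ext fun u v => by
        simp [tensorLeft_tmulA, smul_smul]))
    (AlgHom.ofLinearMap
      { toFun := tensorRight U V
        map_add' := fun a b => tensorA_hom_ext fun u v => by
          simp [tensorRight_tmulA, TensorProduct.tmul_add, add_smul, tmulA_add_right]
        map_smul' := fun c a => tensorA_hom_ext fun u v => by
          simp [tensorRight_tmulA, smul_assoc, tmulA_smul_right] }
      (tensorA_hom_ext fun u v => by
        simp [tensorRight_tmulA, ← Algebra.TensorProduct.one_def])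
      (fun a b => tensorA_hom_ext fun u v => by
        simp [tensorRight_tmulA, smul_smul]))
    (fun a b => (commute_iff_eq _ _).2 (tensorA_hom_ext fun u v => by
      simp [tensorRight_tmulA, tensorLeft_tmulA]))

instance (U V : ModuleCat.{v} (Env k A)) : Module (Env k A) (tensorA U V) :=
  Module.compHom _ (tensorAct U V).toRingHom

theorem env_smul_tmulA {U V : ModuleCat.{v} (Env k A)} (a b : A) (u : U) (v : V) :
    (a ⊗ₜ op b : Env k A) • tmulA u v
      = tmulA ((a ⊗ₜ 1 : Env k A) • u) ((1 ⊗ₜ op b : Env k A) • v) := by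
  change tensorAct U V (a ⊗ₜ op b) (tmulA u v) = _
  have h : tensorAct U V (a ⊗ₜ op b) = tensorLeft U V a * tensorRight U V (op b) :=
    Algebra.TensorProduct.lift_tmul _ _ _ _ _
  rw [h]
  rfl

/-- Invertible bimodules. -/
def IsInvertible (U : ModuleCat.{v} (Env k A)) : Prop :=
  ∃ V : ModuleCat.{v} (Env k A),
    Nonempty (tensorA U V ≃ₗ[Env k A] A) ∧ Nonempty (tensorA V U ≃ₗ[Env k A] A)

variable (k A)

/-- `A` has a finite resolution by finitely generated projective modules over its enveloping
algebra. -/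
def IsHomologicallySmooth : Prop :=
  ∃ P : ProjectiveResolution (ModuleCat.of (Env k A) A),
    (∀ n, Module.Finite (Env k A) (P.complex.X n)) ∧
    ∃ N : ℕ, ∀ n, N < n → Limits.IsZero (P.complex.X n)

/-- Twisted Calabi–Yau algebras of dimension `d`. The right module `Ext^d` is a bimodule through
`a · x · b = x · (b ⊗ op a)`. -/
def IsTwistedCY (d : ℕ) : Prop :=
  IsHomologicallySmooth k A ∧
  ∃ U : ModuleCat.{v} (Env k A), IsInvertible U ∧
    (∀ i, i ≠ d → Subsingleton (ExtR (ModuleCat.of (Env k A) A) i)) ∧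
    ∃ φ : ExtR (ModuleCat.of (Env k A) A) d ≃+ U,
      ∀ (a b : A) (x : ExtR (ModuleCat.of (Env k A) A) d),
        φ (op (b ⊗ₜ op a : Env k A) • x) = (a ⊗ₜ op b : Env k A) • φ x

end Bimodules

/-! ### Graded bimodules -/

section GradedBimodules

open MulOpposite

variable {k : Type u} [Field k] {A : Type v} [Ring A] [Algebra k A]
variable {G : Type w} [AddCommGroup G] [DecidableEq G]

/-- The grading of the enveloping algebra: degree `γ` is spanned by the `a ⊗ op b` with `a`, `b`
homogeneous of degrees adding up to `γ`. -/
def envGrading (𝒜 : G → Submodule k A) (γ : G) : Submodule k (Env k A) :=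
  Submodule.span k {x | ∃ (i j : G) (a b : A),
    i + j = γ ∧ a ∈ 𝒜 i ∧ b ∈ 𝒜 j ∧ x = a ⊗ₜ[k] op b}

variable (𝒜 : G → Submodule k A) [GradedAlgebra 𝒜]

/-- An element of `A` as the family of its homogeneous components. -/
def comps : A →ₗ[k] (G →₀ A) :=
  DirectSum.toModule k G (G →₀ A) (fun i => Finsupp.lsingle i ∘ₗ (𝒜 i).subtype) ∘ₗ
    (DirectSum.decomposeLinearEquiv 𝒜).toLinearMap

theorem comps_of_mem {i : G} {a : A} (ha : a ∈ 𝒜 i) : comps 𝒜 a = Finsupp.single i a := by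
  lift a to 𝒜 i using ha
  simp [comps]

/-- The projection of the enveloping algebra onto its component of degree `γ`. -/
def envProj (γ : G) : Env k A →ₗ[k] Env k A :=
  Finsupp.lapply γ ∘ₗ Finsupp.lmapDomain (Env k A) k (fun p : G × G => p.1 + p.2) ∘ₗ
    (finsuppTensorFinsupp k k A Aᵐᵒᵖ G G).toLinearMap ∘ₗ
    TensorProduct.map (comps 𝒜)
      (Finsupp.mapRange.linearMap (opLinearEquiv k).toLinearMap ∘ₗ comps 𝒜 ∘ₗ
        (opLinearEquiv k).symm.toLinearMap)

theorem envProj_tmul (γ : G) {i j : G} {a b : A} (ha : a ∈ 𝒜 i) (hb : b ∈ 𝒜 j) :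
    envProj 𝒜 γ (a ⊗ₜ op b) = if i + j = γ then a ⊗ₜ op b else 0 := by
  simp [envProj, comps_of_mem 𝒜 ha, comps_of_mem 𝒜 hb, Finsupp.mapDomain_single,
    Finsupp.single_apply]

theorem envProj_same (γ : G) (x : Env k A) (hx : x ∈ envGrading 𝒜 γ) : envProj 𝒜 γ x = x := by
  induction hx using Submodule.span_induction with
  | mem x h =>
    obtain ⟨i, j, a, b, h, ha, hb, rfl⟩ := h
    rw [envProj_tmul 𝒜 γ ha hb, if_pos h]
  | zero => simp
  | add x y _ _ hx hy => rw [map_add, hx, hy]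
  | smul c x _ hx => rw [map_smul, hx]

theorem envProj_ne (γ δ : G) (hδ : δ ≠ γ) (x : Env k A) (hx : x ∈ envGrading 𝒜 δ) :
    envProj 𝒜 γ x = 0 := by
  induction hx using Submodule.span_induction with
  | mem x h =>
    obtain ⟨i, j, a, b, h, ha, hb, rfl⟩ := h
    rw [envProj_tmul 𝒜 γ ha hb, if_neg (h ▸ hδ)]
  | zero => simp
  | add x y _ _ hx hy => rw [map_add, hx, hy, add_zero]
  | smul c x _ hx => rw [map_smul, hx, smul_zero]

theorem env_iSup : ⨆ γ, (envGrading 𝒜 γ).toAddSubgroup = ⊤ := by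
  classical
  rw [eq_top_iff]
  intro x _
  induction x using TensorProduct.induction_on with
  | zero => exact zero_mem _
  | add x y hx hy => exact add_mem (hx trivial) (hy trivial)
  | tmul a b =>
    rw [← DirectSum.sum_support_decompose 𝒜 a, ← op_unop b,
      ← DirectSum.sum_support_decompose 𝒜 b.unop, Finset.op_sum, TensorProduct.sum_tmul]
    refine sum_mem fun i _ => ?_
    rw [TensorProduct.tmul_sum]
    exact sum_mem fun j _ => AddSubgroup.mem_iSup_of_mem (i + j)
      (Submodule.subset_span ⟨i, j, _, _, rfl, SetLike.coe_mem _, SetLike.coe_mem _, rfl⟩)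

theorem env_isInternal : DirectSum.IsInternal (envGrading 𝒜) :=
  isInternal_of_proj (fun γ => (envGrading 𝒜 γ).toAddSubgroup) (env_iSup 𝒜)
    (fun γ => (envProj 𝒜 γ).toAddMonoidHom) (envProj_same 𝒜) (envProj_ne 𝒜)

instance : GradedAlgebra (envGrading 𝒜) where
  toDecomposition := (env_isInternal 𝒜).chooseDecomposition
  one_mem := Submodule.subset_span ⟨0, 0, 1, 1, add_zero 0, SetLike.GradedOne.one_mem,
    SetLike.GradedOne.one_mem, rfl⟩
  mul_mem := by
    intro γ δ x y hx hy
    refine Submodule.span_induction₂ (p := fun x y _ _ => x * y ∈ envGrading 𝒜 (γ + δ))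
      ?_ ?_ ?_ ?_ ?_ ?_ ?_ hx hy
    · rintro _ _ ⟨i, j, a, b, rfl, ha, hb, rfl⟩ ⟨i', j', a', b', rfl, ha', hb', rfl⟩
      refine Submodule.subset_span ⟨i + i', j' + j, a * a', b' * b, by abel,
        SetLike.GradedMul.mul_mem ha ha', SetLike.GradedMul.mul_mem hb' hb, by simp⟩
    · intro y _; simp
    · intro x _; simp
    · intro x y z _ _ _ h1 h2; rw [add_mul]; exact add_mem h1 h2
    · intro x y z _ _ _ h1 h2; rw [mul_add]; exact add_mem h1 h2
    · intro c x y _ _ h; rw [smul_mul_assoc]; exact Submodule.smul_mem _ _ h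
    · intro c x y _ _ h; rw [mul_smul_comm]; exact Submodule.smul_mem _ _ h

/-- `A` as a graded bimodule over itself. -/
abbrev grSelf : GrMod (envGrading 𝒜) where
  carrier := A
  deg i := (𝒜 i).toAddSubgroup
  isInternal := DirectSum.Decomposition.isInternal 𝒜
  smul_mem := by
    intro γ i r m hr hm
    induction hr using Submodule.span_induction with
    | mem x h =>
      obtain ⟨i', j', a, b, rfl, ha, hb, rfl⟩ := h
      rw [env_smul]
      have := SetLike.GradedMul.mul_mem (SetLike.GradedMul.mul_mem ha hm) hb
      rwa [add_right_comm] at this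
    | zero =>
      have h0 : (0 : Env k A) • m = 0 := zero_smul (Env k A) m
      exact h0 ▸ zero_mem (𝒜 (γ + i))
    | add x y _ _ hx hy => rw [add_smul]; exact add_mem hx hy
    | smul c x _ hx =>
      have h1 : (c • x) • m = c • (x • m) := by
        have : c • x = (algebraMap k A c ⊗ₜ op 1 : Env k A) * x := by
          exact Algebra.smul_def c x
        rw [this, mul_smul, env_smul, mul_one, Algebra.smul_def]
      rw [h1]
      exact (𝒜 (γ + i)).smul_mem c hx

variable {𝒜}

/-- The bimodule underlying a graded bimodule. -/
abbrev GrMod.forget (U : GrMod (envGrading 𝒜)) : ModuleCat.{v} (Env k A) :=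
  ModuleCat.of (Env k A) U.carrier

/-- The grading of `U ⊗_A V`: degree `γ` is spanned by the `u ⊗ v` with `u`, `v` homogeneous of
degrees adding up to `γ`. -/
def tensorDeg (U V : GrMod (envGrading 𝒜)) (γ : G) : AddSubgroup (tensorA U.forget V.forget) :=
  AddSubgroup.closure {x | ∃ (i j : G) (u : U.carrier) (v : V.carrier),
    i + j = γ ∧ u ∈ U.deg i ∧ v ∈ V.deg j ∧ x = tmulA (U := U.forget) (V := V.forget) u v}

/-- Graded invertible graded bimodules. -/
def IsGrInvertible (U : GrMod (envGrading 𝒜)) : Prop :=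
  ∃ V : GrMod (envGrading 𝒜),
    (∃ e : tensorA U.forget V.forget ≃ₗ[Env k A] A, ∀ γ x, x ∈ tensorDeg U V γ ↔ e x ∈ 𝒜 γ) ∧
    (∃ e : tensorA V.forget U.forget ≃ₗ[Env k A] A, ∀ γ x, x ∈ tensorDeg V U γ ↔ e x ∈ 𝒜 γ)

variable (𝒜)

/-- `A` has a finite resolution by finitely generated projectives in the category of graded
modules over its enveloping algebra. -/
def IsGrHomologicallySmooth : Prop :=
  ∃ P : GrProjRes (grSelf 𝒜),
    (∀ n, Module.Finite (Env k A) (P.X n).carrier) ∧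
    ∃ N : ℕ, ∀ n, N < n → Subsingleton (P.X n).carrier

/-- Graded twisted Calabi–Yau algebras of dimension `d`. The right module `Ext^d` is a bimodule
through `a · x · b = x · (b ⊗ op a)`. -/
def IsGrTwistedCY (d : ℕ) : Prop :=
  IsGrHomologicallySmooth 𝒜 ∧
  ∃ U : GrMod (envGrading 𝒜), IsGrInvertible U ∧
    (∀ i, i ≠ d → Subsingleton (grExt (grSelf 𝒜) i)) ∧
    ∃ φ : grExt (grSelf 𝒜) d ≃+ U.carrier,
      (∀ (a b : A) (x : grExt (grSelf 𝒜) d),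
        φ (op (b ⊗ₜ op a : Env k A) • x) = (a ⊗ₜ op b : Env k A) • φ x) ∧
      ∀ γ x, x ∈ grExtDeg (grSelf 𝒜) d γ ↔ φ x ∈ U.deg γ

end GradedBimodules

end GradedCY

end

/-! Forgetting gradings gives one direction once graded projectives are known to be projective and
graded Ext is known to be Ext. The other direction needs gradings on objects that come without one:
the resolution, the bimodule `U`, and the inverse `V` of `U`.

The basic tool is `homComponent`. A linear map `f` between graded modules has a component of each
degree `τ`, and if the source is finitely generated then `f` is a finite sum of components
(`exists_sum_homComponent`). The degree zero component of an ungraded lift of a graded map is a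
graded lift, so a graded module is projective in the graded category exactly when it is projective.
For finitely generated `M` the total group HOM is all of Hom (`totalHom_eq_top`), so a graded
resolution by finitely generated projectives computes graded and ungraded Ext by the same complex.
The comparison theorem for resolutions carries this over to the resolution chosen in `grExt`.

For smoothness, a finite ungraded resolution is not graded itself, but it bounds any other: by
Schanuel's lemma, the kernel of any cover of `M` by a finitely generated projective has a finite
resolution that is one step shorter (`HasFiniteResolution.ker`). Taking graded free covers
repeatedly therefore ends in a graded projective kernel.

The bimodule `U` inherits the grading of the graded Ext. To see that it is graded invertible, let
`V` be an ungraded inverse with pairings `e : U ⊗ V ≃ A` and `e' : V ⊗ U ≃ A`. After correcting `e'`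
by a central unit the pairings satisfy `(u, v) u' = u (v, u')` (`IsInvertible.exists_compatible`).
Writing `1` as a sum of values of `e'` then gives a finite dual basis, which identifies `V` with
`Hom_A(U, A)`. Since `U` is finitely generated on the left, `V` is the direct sum of the
homomorphisms of each degree, and both pairings respect degrees. -/

noncomputable section

namespace GradedCY

/-! ### Homogeneous components of homomorphisms -/

section Components

variable {k : Type u} [Field k] {G : Type w} [AddCommGroup G] [DecidableEq G]
variable {R : Type v} [Ring R] [Algebra k R] {𝓡 : G → Submodule k R}

@[elab_as_elim]
theorem GrMod.homogeneous_induction (M : GrMod 𝓡) {p : M.carrier → Prop} (x : M.carrier)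
    (hom : ∀ i, ∀ m ∈ M.deg i, p m) (zero : p 0) (add : ∀ x y, p x → p y → p (x + y)) : p x := by
  have hx : x ∈ ⨆ i, M.deg i := M.iSup_deg ▸ AddSubgroup.mem_top x
  induction hx using AddSubgroup.iSup_induction' with
  | hp i x hx => exact hom i x hx
  | h1 => exact zero
  | hadd x y _ _ h1 h2 => exact add x y h1 h2

theorem GrMod.proj_proj (M : GrMod 𝓡) (i j : G) (x : M.carrier) :
    M.proj i (M.proj j x) = if j = i then M.proj j x else 0 := by
  split_ifs with h
  · subst h
    exact M.proj_same _ _ (M.proj_mem _ _)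
  · exact M.proj_ne _ _ h _ (M.proj_mem _ _)

/-- Any sufficiently large finite set of degrees recovers an element from its components. -/
theorem GrMod.exists_sum_proj_of_subset (M : GrMod 𝓡) (x : M.carrier) :
    ∃ s : Finset G, ∀ t, s ⊆ t → x = ∑ i ∈ t, M.proj i x := by
  obtain ⟨s, hs⟩ := M.exists_sum_proj x
  refine ⟨s, fun t hst => ?_⟩
  refine hs.trans (Finset.sum_subset hst fun i _ hi => ?_)
  rw [hs, map_sum]
  refine Finset.sum_eq_zero fun j hj => ?_
  rw [M.proj_proj, if_neg]
  rintro rfl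
  exact hi hj

/-- A homogeneous scalar shifts every degree by `i`, and translation by `i` is injective on `G`, so
no other component of `x` reaches degree `i + j`. -/
theorem GrMod.proj_smul_of_mem (M : GrMod 𝓡) {i : G} {r : R} (hr : r ∈ 𝓡 i) (j : G)
    (x : M.carrier) : M.proj (i + j) (r • x) = r • M.proj j x := by
  refine M.homogeneous_induction x (fun l m hm => ?_) ?_ (fun x y hx hy => ?_)
  · by_cases h : l = j
    · subst h
      rw [M.proj_same _ _ hm, M.proj_same _ _ (M.smul_mem hr hm)]
    · rw [M.proj_ne _ _ h _ hm, smul_zero,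
        M.proj_ne _ _ (fun h' => h (add_left_cancel h')) _ (M.smul_mem hr hm)]
  · simp
  · rw [smul_add, map_add, hx, hy, map_add, smul_add]

/-- The component of degree `τ` of an additive map between graded modules. -/
def addComponent (M N : GrMod 𝓡) (f : M.carrier →+ N.carrier) (τ : G) : M.carrier →+ N.carrier :=
  letI := M.isInternal.chooseDecomposition
  (DirectSum.toAddMonoid fun σ => ((N.proj (σ + τ)).comp f).comp (M.deg σ).subtype).comp
    (DirectSum.decomposeAddEquiv M.deg).toAddMonoidHom

theorem addComponent_of_mem {M N : GrMod 𝓡} (f : M.carrier →+ N.carrier) (τ : G) {σ : G}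
    {m : M.carrier} (hm : m ∈ M.deg σ) : addComponent M N f τ m = N.proj (σ + τ) (f m) := by
  let _ := M.isInternal.chooseDecomposition
  have : DirectSum.decompose M.deg m = DirectSum.of (fun i => M.deg i) σ ⟨m, hm⟩ :=
    DirectSum.decompose_of_mem M.deg hm
  change (DirectSum.toAddMonoid fun σ => ((N.proj (σ + τ)).comp f).comp (M.deg σ).subtype)
    (DirectSum.decompose M.deg m) = _
  rw [this, DirectSum.toAddMonoid_of]
  rfl

@[elab_as_elim]
theorem homogeneous_ring_induction [GradedAlgebra 𝓡] {p : R → Prop} (r : R) (hom : ∀ i, ∀ r ∈ 𝓡 i, p r)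
    (zero : p 0) (add : ∀ x y, p x → p y → p (x + y)) : p r :=
  DirectSum.Decomposition.inductionOn 𝓡 zero (fun {i} m => hom i m.1 m.2) add r

variable [GradedAlgebra 𝓡]

/-- The component of degree `τ` of a homomorphism between graded modules. -/
def homComponent {M N : GrMod 𝓡} (f : M.carrier →ₗ[R] N.carrier) (τ : G) :
    M.carrier →ₗ[R] N.carrier where
  toFun := addComponent M N f.toAddMonoidHom τ
  map_add' := map_add _
  map_smul' := by
    intro r m
    rw [RingHom.id_apply]
    -- Both sides are additive in `r` and in `m`. For homogeneous `r` and `m` the claim is that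
    -- projections commute with `r` up to the shift of degree.
    refine homogeneous_ring_induction (𝓡 := 𝓡) r (fun i r hr => ?_) ?_ (fun x y hx hy => ?_)
    · refine M.homogeneous_induction m (fun σ m hm => ?_) ?_ (fun x y hx hy => ?_)
      · rw [addComponent_of_mem _ _ hm, addComponent_of_mem _ _ (M.smul_mem hr hm), add_assoc,
          ← N.proj_smul_of_mem hr]
        simp
      · simp
      · rw [smul_add, map_add, hx, hy, map_add, smul_add]
    · simp
    · rw [add_smul, map_add, hx, hy, add_smul]

theorem homComponent_of_mem {M N : GrMod 𝓡} (f : M.carrier →ₗ[R] N.carrier) (τ : G) {σ : G}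
    {m : M.carrier} (hm : m ∈ M.deg σ) : homComponent f τ m = N.proj (σ + τ) (f m) :=
  addComponent_of_mem _ _ hm

theorem homComponent_mem {M N : GrMod 𝓡} (f : M.carrier →ₗ[R] N.carrier) (τ : G) {σ : G}
    {m : M.carrier} (hm : m ∈ M.deg σ) : homComponent f τ m ∈ N.deg (σ + τ) := by
  rw [homComponent_of_mem f τ hm]
  exact N.proj_mem _ _

theorem linearMap_ext_homogeneous {M : GrMod 𝓡} {N : Type*} [AddCommGroup N] [Module R N]
    {f g : M.carrier →ₗ[R] N} (h : ∀ i, ∀ m ∈ M.deg i, f m = g m) : f = g := by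
  ext x
  refine M.homogeneous_induction x h ?_ (fun x y hx hy => ?_)
  · simp
  · simp [hx, hy]

theorem homComponent_add {M N : GrMod 𝓡} (f g : M.carrier →ₗ[R] N.carrier) (τ : G) :
    homComponent (f + g) τ = homComponent f τ + homComponent g τ :=
  linearMap_ext_homogeneous fun i m hm => by simp [homComponent_of_mem _ _ hm]

theorem homComponent_comp {M M' N : GrMod 𝓡} (f : M.carrier →ₗ[R] N.carrier)
    {g : M'.carrier →ₗ[R] M.carrier} (hg : IsGrHom M' M g) (τ : G) :
    homComponent (f ∘ₗ g) τ = homComponent f τ ∘ₗ g :=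
  linearMap_ext_homogeneous fun i m hm => by
    simp [homComponent_of_mem _ _ hm, homComponent_of_mem _ _ (hg i m hm)]

theorem comp_homComponent {M N N' : GrMod 𝓡} (f : M.carrier →ₗ[R] N.carrier)
    {g : N.carrier →ₗ[R] N'.carrier} (hg : IsGrHom N N' g) (τ : G) :
    homComponent (g ∘ₗ f) τ = g ∘ₗ homComponent f τ :=
  linearMap_ext_homogeneous fun i m hm => by
    simp [homComponent_of_mem _ _ hm, hg.map_proj]

/-- A map of degree `τ` is its own component of degree `τ`. -/
theorem homComponent_same {M N : GrMod 𝓡} {f : M.carrier →ₗ[R] N.carrier} {τ : G}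
    (hf : ∀ σ, ∀ m ∈ M.deg σ, f m ∈ N.deg (σ + τ)) : homComponent f τ = f :=
  linearMap_ext_homogeneous fun i m hm => by
    rw [homComponent_of_mem _ _ hm, N.proj_same _ _ (hf i m hm)]

theorem homComponent_ne {M N : GrMod 𝓡} {f : M.carrier →ₗ[R] N.carrier} {τ τ' : G} (h : τ' ≠ τ)
    (hf : ∀ σ, ∀ m ∈ M.deg σ, f m ∈ N.deg (σ + τ')) : homComponent f τ = 0 :=
  linearMap_ext_homogeneous fun i m hm => by
    rw [homComponent_of_mem _ _ hm, N.proj_ne _ (i + τ') (by simpa using h) _ (hf i m hm)]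
    rfl

/-- A finitely generated graded module has a finite set of homogeneous generators. -/
theorem GrMod.exists_homogeneous_generators (M : GrMod 𝓡) [Module.Finite R M.carrier] :
    ∃ s : Finset M.carrier, (∀ m ∈ s, ∃ i, m ∈ M.deg i) ∧
      Submodule.span R (s : Set M.carrier) = ⊤ := by
  classical
  obtain ⟨t, ht⟩ := Module.Finite.fg_top (R := R) (M := M.carrier)
  choose c hc using M.exists_sum_proj
  refine ⟨t.biUnion fun x => (c x).image fun i => M.proj i x, ?_, ?_⟩
  · intro m hm
    simp only [Finset.mem_biUnion, Finset.mem_image] at hm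
    obtain ⟨x, _, i, _, rfl⟩ := hm
    exact ⟨i, M.proj_mem _ _⟩
  · rw [eq_top_iff, ← ht, Submodule.span_le]
    intro x hx
    rw [hc x]
    refine sum_mem fun i hi => Submodule.subset_span ?_
    simp only [Finset.coe_biUnion, Set.mem_iUnion, Finset.mem_coe, Finset.mem_image]
    exact ⟨x, hx, i, hi, rfl⟩

/-- A homomorphism from a finitely generated graded module is the sum of its components. -/
theorem exists_sum_homComponent {M N : GrMod 𝓡} [Module.Finite R M.carrier]
    (f : M.carrier →ₗ[R] N.carrier) :
    ∃ s : Finset G, ∀ t, s ⊆ t → f = ∑ τ ∈ t, homComponent f τ := by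
  classical
  obtain ⟨g, hg, hspan⟩ := M.exists_homogeneous_generators
  choose! e he using hg
  choose c hc using fun m => N.exists_sum_proj_of_subset (f m)
  -- On a generator `m` of degree `e m`, the part of `f m` in degree `i` comes from the component of
  -- `f` of degree `i - e m`. Finitely many generators with finitely many such `i` leave finitely
  -- many degrees.
  refine ⟨g.biUnion fun m => (c m).image fun i => -e m + i, fun t ht => ?_⟩
  refine LinearMap.ext_on hspan fun m hm => ?_
  have hmt : c m ⊆ t.image fun i => e m + i := by
    intro i hi
    refine Finset.mem_image.2 ⟨-e m + i, ht ?_, by simp⟩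
    exact Finset.mem_biUnion.2 ⟨m, hm, Finset.mem_image.2 ⟨i, hi, rfl⟩⟩
  rw [LinearMap.sum_apply, hc m _ hmt,
    Finset.sum_image (fun x _ y _ h => add_left_cancel h)]
  exact Finset.sum_congr rfl fun τ _ => (homComponent_of_mem f τ (he m hm)).symm

end Components

/-! ### Graded projective modules -/

section Projective

variable {k : Type u} [Field k] {G : Type w} [AddCommGroup G] [DecidableEq G]
variable {R : Type v} [Ring R] [Algebra k R] {𝓡 : G → Submodule k R} [GradedAlgebra 𝓡]

/-- Homogeneous generators of a graded module define a graded free cover. -/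
theorem GrMod.exists_free_cover (M : GrMod 𝓡) {ι : Type v} (x : ι → M.carrier) (e : ι → G)
    (hx : ∀ i, x i ∈ M.deg (e i)) (hspan : Submodule.span R (Set.range x) = ⊤) :
    ∃ p : (GrMod.free 𝓡 ι e).carrier →ₗ[R] M.carrier,
      IsGrHom (GrMod.free 𝓡 ι e) M p ∧ Function.Surjective p := by
  classical
  let p : (Π₀ _ : ι, R) →ₗ[R] M.carrier :=
    DFinsupp.lsum ℕ fun i : ι => LinearMap.toSpanSingleton R M.carrier (x i)
  refine ⟨p, ?_, ?_⟩
  · intro γ f hf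
    have : p f = f.sum fun i r => r • x i := by
      simp [p, DFinsupp.sumAddHom_apply]
      rfl
    rw [this]
    refine sum_mem fun i _ => ?_
    have := M.smul_mem (hf i) (hx i)
    rwa [sub_add_cancel] at this
  · rw [← LinearMap.range_eq_top, eq_top_iff, ← hspan, Submodule.span_le]
    rintro _ ⟨i, rfl⟩
    exact ⟨DFinsupp.single i (1 : R), by simp [p]⟩

/-- Projective objects of the category of graded modules are projective modules. -/
theorem IsGrProjective.projective {P : GrMod 𝓡} (hP : IsGrProjective P) :
    Module.Projective R P.carrier := by
  classical
  let ι : Type v := {m : P.carrier // ∃ i, m ∈ P.deg i}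
  obtain ⟨p, hp, hs⟩ := P.exists_free_cover (ι := ι) Subtype.val (fun m => m.2.choose)
    (fun m => m.2.choose_spec) (by
      rw [eq_top_iff]
      intro x _
      refine P.homogeneous_induction x (fun i m hm => Submodule.subset_span ⟨⟨m, i, hm⟩, rfl⟩)
        (zero_mem _) (fun x y hx hy => add_mem hx hy))
  -- Lifting the identity along a free cover makes `P` a direct summand of a free module.
  obtain ⟨h, -, hh⟩ := hP _ _ p LinearMap.id hp hs (fun _ _ hm => hm)
  have : Module.Projective R (Π₀ _ : ι, R) := inferInstance
  exact Module.Projective.of_split h p hh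

/-- A graded module that is projective as a module is a projective object of the category of
graded modules. -/
theorem isGrProjective_of_projective (P : GrMod 𝓡) [Module.Projective R P.carrier] :
    IsGrProjective P := by
  intro X Y q g hq hs hg
  obtain ⟨h, hh⟩ := Module.projective_lifting_property q g hs
  -- The degree zero component of an ungraded lift is still a lift: taking components commutes with
  -- the graded map `q`, and `g` is its own component of degree zero.
  refine ⟨homComponent h 0, fun i m hm => ?_, ?_⟩
  · simpa using homComponent_mem h 0 hm
  · rw [← comp_homComponent h hq, hh, homComponent_same]
    exact fun σ m hm => by simpa using hg σ m hm

/-- A finitely generated graded module is a graded quotient of a finitely generated graded free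
module. -/
theorem GrMod.exists_finite_cover (M : GrMod 𝓡) [Module.Finite R M.carrier] :
    ∃ (F : GrMod 𝓡) (p : F.carrier →ₗ[R] M.carrier), IsGrProjective F ∧
      Module.Finite R F.carrier ∧ IsGrHom F M p ∧ Function.Surjective p := by
  classical
  obtain ⟨s, hs, hspan⟩ := M.exists_homogeneous_generators
  choose e he using hs
  obtain ⟨p, hp, hsurj⟩ := M.exists_free_cover (ι := {m // m ∈ s}) Subtype.val
    (fun m => e m.1 m.2) (fun m => he m.1 m.2) (by simpa using hspan)
  refine ⟨_, p, GrMod.free_isGrProjective _ _, ?_, hp, hsurj⟩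
  exact Module.Finite.equiv (DFinsupp.linearEquivFunOnFintype (R := R)
    (M := fun _ : {m // m ∈ s} => R)).symm

/-- The graded submodule of a graded module on a submodule stable under the projections. -/
abbrev GrMod.sub (M : GrMod 𝓡) (N : Submodule R M.carrier)
    (hN : ∀ i, ∀ x ∈ N, M.proj i x ∈ N) : GrMod 𝓡 where
  carrier := N
  deg i := (M.deg i).comap N.subtype.toAddMonoidHom
  isInternal := by
    refine isInternal_of_proj _ ?_
      (fun i => AddMonoidHom.mk' (fun x => ⟨M.proj i x.1, hN i x.1 x.2⟩)
        (fun x y => Subtype.ext (by simp))) ?_ ?_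
    · rw [eq_top_iff]
      intro x _
      obtain ⟨s, hs⟩ := M.exists_sum_proj x.1
      have : x = ∑ i ∈ s, (⟨M.proj i x.1, hN i x.1 x.2⟩ : N) :=
        Subtype.ext (by simpa using hs)
      rw [this]
      exact sum_mem fun i _ => AddSubgroup.mem_iSup_of_mem i (M.proj_mem i x.1)
    · exact fun i x hx => Subtype.ext (M.proj_same i x.1 hx)
    · exact fun i j h x hx => Subtype.ext (M.proj_ne i j h x.1 hx)
  smul_mem hr hm := M.smul_mem hr hm

/-- Graded maps from a graded projective lift along graded maps that cover their values. -/
theorem IsGrProjective.exists_lift {P X Y : GrMod 𝓡} (hP : IsGrProjective P)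
    {q : X.carrier →ₗ[R] Y.carrier} {g : P.carrier →ₗ[R] Y.carrier} (hq : IsGrHom X Y q)
    (hg : IsGrHom P Y g) (h : ∀ x, g x ∈ LinearMap.range q) :
    ∃ f : P.carrier →ₗ[R] X.carrier, IsGrHom P X f ∧ q ∘ₗ f = g := by
  -- Graded projectivity lifts along surjections only, so `Y` is replaced by the range of `q`, which
  -- is stable under projections because `q` is graded.
  obtain ⟨f, hf, hqf⟩ := hP X
    (Y.sub (LinearMap.range q) (by
      rintro i _ ⟨x, rfl⟩
      exact ⟨X.proj i x, hq.map_proj i x⟩))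
    q.rangeRestrict (g.codRestrict _ h) (fun i m hm => hq i m hm) q.surjective_rangeRestrict
    (fun i m hm => hg i m hm)
  refine ⟨f, hf, LinearMap.ext fun x => ?_⟩
  exact congrArg Subtype.val (LinearMap.congr_fun hqf x)

end Projective

/-! ### Maps between subquotients -/

section Subquotient

variable {S W W' : Type*} [Ring S] [AddCommGroup W] [Module S W] [AddCommGroup W'] [Module S W']

theorem Subquotient.mk_surjective (Z B : Submodule S W) :
    Function.Surjective (Subquotient.mk Z B) :=
  Submodule.mkQ_surjective _

theorem Subquotient.mk_eq_zero_iff {Z B : Submodule S W} {z : Z} :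
    Subquotient.mk Z B z = 0 ↔ z.1 ∈ B :=
  (Submodule.Quotient.mk_eq_zero _).trans Iff.rfl

theorem Subquotient.mk_eq_iff {Z B : Submodule S W} {z z' : Z} :
    Subquotient.mk Z B z = Subquotient.mk Z B z' ↔ z.1 - z'.1 ∈ B := by
  rw [← sub_eq_zero, ← map_sub, Subquotient.mk_eq_zero_iff]
  rfl

/-- The map between subquotients induced by a linear map. -/
def Subquotient.map {Z B : Submodule S W} {Z' B' : Submodule S W'} (f : W →ₗ[S] W')
    (hZ : ∀ x ∈ Z, f x ∈ Z') (hB : ∀ x ∈ B, f x ∈ B') :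
    Subquotient Z B →ₗ[S] Subquotient Z' B' :=
  (B.submoduleOf Z).mapQ (B'.submoduleOf Z') (f.restrict hZ) fun x hx => hB x.1 hx

/-- The additive endomorphism of a subquotient induced by an additive endomorphism. -/
def Subquotient.addMap {Z B : Submodule S W} (f : W →+ W)
    (hZ : ∀ x ∈ Z, f x ∈ Z) (hB : ∀ x ∈ B, f x ∈ B) :
    Subquotient Z B →+ Subquotient Z B :=
  QuotientAddGroup.map (B.submoduleOf Z).toAddSubgroup (B.submoduleOf Z).toAddSubgroup
    (AddMonoidHom.mk' (fun z : Z => (⟨f z.1, hZ z.1 z.2⟩ : Z)) fun x y => Subtype.ext (by simp))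
    fun x hx => hB x.1 hx

theorem Subquotient.addMap_mk {Z B : Submodule S W} (f : W →+ W)
    (hZ : ∀ x ∈ Z, f x ∈ Z) (hB : ∀ x ∈ B, f x ∈ B) (z : Z) :
    Subquotient.addMap f hZ hB (Subquotient.mk Z B z) = Subquotient.mk Z B ⟨f z.1, hZ z.1 z.2⟩ :=
  rfl

end Subquotient

/-! ### The total `HOM` into the algebra -/

section TotalHom

variable {k : Type u} [Field k] {G : Type w} [AddCommGroup G] [DecidableEq G]
variable {R : Type v} [Ring R] [Algebra k R] {𝓡 : G → Submodule k R} [GradedAlgebra 𝓡]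

variable (𝓡) in
/-- The graded algebra as a graded module over itself. -/
abbrev GrMod.regular : GrMod 𝓡 where
  carrier := R
  deg i := (𝓡 i).toAddSubgroup
  isInternal := DirectSum.Decomposition.isInternal 𝓡
  smul_mem hr hm := SetLike.GradedMul.mul_mem hr hm

/-- The component of degree `τ` of a homomorphism into the algebra. -/
def dualComponent (M : GrMod 𝓡) (τ : G) : (M.carrier →ₗ[R] R) →+ (M.carrier →ₗ[R] R) :=
  AddMonoidHom.mk' (fun f => homComponent (N := GrMod.regular 𝓡) f τ)
    (fun f g => homComponent_add (N := GrMod.regular 𝓡) f g τ)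

theorem dualComponent_mem (M : GrMod 𝓡) (τ : G) (f : M.carrier →ₗ[R] R) :
    dualComponent M τ f ∈ homDeg M τ :=
  fun _ _ hm => homComponent_mem (N := GrMod.regular 𝓡) f τ hm

theorem homDeg_le_totalHom (M : GrMod 𝓡) (τ : G) {f : M.carrier →ₗ[R] R} (hf : f ∈ homDeg M τ) :
    f ∈ totalHom M :=
  AddSubgroup.mem_iSup_of_mem (S := homDeg M) τ hf

theorem dualComponent_same {M : GrMod 𝓡} {τ : G} {f : M.carrier →ₗ[R] R} (hf : f ∈ homDeg M τ) :
    dualComponent M τ f = f :=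
  homComponent_same (N := GrMod.regular 𝓡) hf

theorem dualComponent_ne {M : GrMod 𝓡} {τ τ' : G} (h : τ' ≠ τ) {f : M.carrier →ₗ[R] R}
    (hf : f ∈ homDeg M τ') : dualComponent M τ f = 0 :=
  homComponent_ne (N := GrMod.regular 𝓡) h hf

theorem dualComponent_precomp {M N : GrMod 𝓡} {g : M.carrier →ₗ[R] N.carrier}
    (hg : IsGrHom M N g) (τ : G) (f : N.carrier →ₗ[R] R) :
    dualComponent M τ (precomp g f) = precomp g (dualComponent N τ f) :=
  homComponent_comp (N := GrMod.regular 𝓡) f hg τ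

theorem precomp_mem_homDeg {M N : GrMod 𝓡} {g : M.carrier →ₗ[R] N.carrier}
    (hg : IsGrHom M N g) {τ : G} {f : N.carrier →ₗ[R] R} (hf : f ∈ homDeg N τ) :
    precomp g f ∈ homDeg M τ :=
  fun σ m hm => hf σ _ (hg σ m hm)

theorem precomp_mem_totalHom {M N : GrMod 𝓡} {g : M.carrier →ₗ[R] N.carrier}
    (hg : IsGrHom M N g) {f : N.carrier →ₗ[R] R} (hf : f ∈ totalHom N) :
    precomp g f ∈ totalHom M := by
  change f ∈ ⨆ τ, homDeg N τ at hf
  induction hf using AddSubgroup.iSup_induction' with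
  | hp τ f hf => exact homDeg_le_totalHom M τ (precomp_mem_homDeg hg hf)
  | h1 => rw [map_zero]; exact zero_mem _
  | hadd x y _ _ h1 h2 => rw [map_add]; exact add_mem h1 h2

/-- Finite generation leaves only finitely many components to sum, so membership in the total HOM is
no condition. This is where graded and ungraded Ext meet. -/
theorem totalHom_eq_top (M : GrMod 𝓡) [Module.Finite R M.carrier] : totalHom M = ⊤ := by
  rw [eq_top_iff]
  intro f _
  obtain ⟨s, hs⟩ := exists_sum_homComponent (N := GrMod.regular 𝓡) f
  have h : f = ∑ τ ∈ s, dualComponent M τ f := hs s subset_rfl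
  rw [h]
  exact sum_mem fun τ _ => homDeg_le_totalHom M τ (dualComponent_mem M τ f)

/-- Replaces finite generation for the resolution behind `grExt`, whose terms may be infinitely
generated. Allowing every larger `t` lets the finite sets of two summands be merged. -/
theorem exists_sum_dualComponent {M : GrMod 𝓡} {f : M.carrier →ₗ[R] R} (hf : f ∈ totalHom M) :
    ∃ s : Finset G, ∀ t, s ⊆ t → f = ∑ τ ∈ t, dualComponent M τ f := by
  change f ∈ ⨆ τ, homDeg M τ at hf
  induction hf using AddSubgroup.iSup_induction' with
  | hp τ f hf =>
    refine ⟨{τ}, fun t ht => ?_⟩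
    rw [Finset.sum_eq_single τ, dualComponent_same hf]
    · exact fun τ' _ h => dualComponent_ne (Ne.symm h) hf
    · exact fun h => absurd (ht (Finset.mem_singleton_self τ)) h
  | h1 => exact ⟨∅, fun t _ => by simp⟩
  | hadd x y _ _ h1 h2 =>
    obtain ⟨s, hs⟩ := h1
    obtain ⟨s', hs'⟩ := h2
    refine ⟨s ∪ s', fun t ht => ?_⟩
    simp only [map_add, Finset.sum_add_distrib]
    rw [← hs t (Finset.subset_union_left.trans ht), ← hs' t (Finset.subset_union_right.trans ht)]

end TotalHom

/-! ### The grading of the cohomology -/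

section Cohomology

variable {k : Type u} [Field k] {G : Type w} [AddCommGroup G] [DecidableEq G]
variable {R : Type v} [Ring R] [Algebra k R] {𝓡 : G → Submodule k R} [GradedAlgebra 𝓡]
variable {M : GrMod 𝓡}

namespace GrProjRes

variable (P : GrProjRes M)

/-- Differentials preserve degrees, so precomposition with them commutes with taking components, and
the complex splits by degree. -/
theorem dualComponent_mem_cocycles (n : ℕ) (τ : G) (f : (P.X n).carrier →ₗ[R] R)
    (hf : f ∈ P.cocycles n) : dualComponent (P.X n) τ f ∈ P.cocycles n := by
  refine ⟨homDeg_le_totalHom _ τ (dualComponent_mem _ τ f), ?_⟩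
  rw [SetLike.mem_coe, LinearMap.mem_ker, ← dualComponent_precomp (P.d_graded n),
    LinearMap.mem_ker.1 hf.2, map_zero]

theorem dualComponent_mem_coboundaries (n : ℕ) (τ : G) (f : (P.X n).carrier →ₗ[R] R)
    (hf : f ∈ P.coboundaries n) : dualComponent (P.X n) τ f ∈ P.coboundaries n := by
  cases n with
  | zero =>
    rw [show f = 0 from hf, map_zero]
    exact zero_mem _
  | succ n =>
    obtain ⟨g, -, rfl⟩ := hf
    rw [dualComponent_precomp (P.d_graded n)]
    exact ⟨_, homDeg_le_totalHom _ τ (dualComponent_mem _ τ g), rfl⟩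

/-- The cohomology is the direct sum of its homogeneous components. -/
theorem cohomology_isInternal (n : ℕ) : DirectSum.IsInternal (P.cohomologyDeg n) := by
  -- The projections are treated as additive maps only: right multiplication by an inhomogeneous
  -- element does not commute with taking components.
  refine isInternal_of_proj _ ?_ (fun τ => Subquotient.addMap (dualComponent (P.X n) τ)
    (P.dualComponent_mem_cocycles n τ) (P.dualComponent_mem_coboundaries n τ)) ?_ ?_
  · rw [eq_top_iff]
    intro x _
    obtain ⟨z, rfl⟩ := Subquotient.mk_surjective _ _ x
    obtain ⟨s, hs⟩ := exists_sum_dualComponent z.2.1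
    have hz : z = ∑ τ ∈ s, (⟨dualComponent (P.X n) τ z.1,
        P.dualComponent_mem_cocycles n τ z.1 z.2⟩ : P.cocycles n) :=
      Subtype.ext (by simpa using hs s subset_rfl)
    rw [hz, map_sum]
    exact sum_mem fun τ _ => AddSubgroup.mem_iSup_of_mem τ ⟨_, dualComponent_mem _ τ z.1, rfl⟩
  · rintro τ _ ⟨z, hz, rfl⟩
    rw [Subquotient.addMap_mk]
    exact congrArg _ (Subtype.ext (dualComponent_same hz))
  · rintro τ τ' h _ ⟨z, hz, rfl⟩
    rw [Subquotient.addMap_mk, Subquotient.mk_eq_zero_iff]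
    change dualComponent (P.X n) τ z.1 ∈ _
    rw [dualComponent_ne h hz]
    exact zero_mem _

theorem smul_mem_cohomologyDeg (n : ℕ) {i τ : G} {r : R} (hr : r ∈ 𝓡 i) {x : P.cohomology n}
    (hx : x ∈ P.cohomologyDeg n τ) :
    MulOpposite.op r • x ∈ P.cohomologyDeg n (τ + i) := by
  obtain ⟨z, hz, rfl⟩ := hx
  refine ⟨MulOpposite.op r • z, fun σ m hm => ?_, map_smul _ _ _⟩
  have := SetLike.GradedMul.mul_mem (hz σ m hm) hr
  rwa [add_assoc] at this

end GrProjRes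

end Cohomology

/-! ### Comparison of graded projective resolutions -/

section Comparison

/-- Dependent choice for the degree-by-degree construction of chain maps and homotopies; the
invariant needed for the next step is packed into `α n`. -/
theorem exists_seq_of_forall_exists {α : ℕ → Type*} (r : ∀ n, α n → α (n + 1) → Prop) (a : α 0)
    (h : ∀ n a, ∃ b, r n a b) : ∃ s : ∀ n, α n, s 0 = a ∧ ∀ n, r n (s n) (s (n + 1)) := by
  choose next hnext using h
  exact ⟨fun n => Nat.rec a next n, rfl, fun n => hnext n _⟩

variable {k : Type u} [Field k] {G : Type w} [AddCommGroup G] [DecidableEq G]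
variable {R : Type v} [Ring R] [Algebra k R] {𝓡 : G → Submodule k R} [GradedAlgebra 𝓡]
variable {M : GrMod 𝓡}

namespace GrProjRes

/-- Morphisms of graded resolutions over the identity. -/
structure Hom (P Q : GrProjRes M) where
  f : ∀ n, (P.X n).carrier →ₗ[R] (Q.X n).carrier
  graded : ∀ n, IsGrHom (P.X n) (Q.X n) (f n)
  comm_ε : Q.ε ∘ₗ f 0 = P.ε
  comm : ∀ n, Q.d n ∘ₗ f (n + 1) = f n ∘ₗ P.d n

theorem d_d (P : GrProjRes M) (n : ℕ) (x : (P.X (n + 2)).carrier) : P.d n (P.d (n + 1) x) = 0 :=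
  (P.exact_succ n).apply_apply_eq_zero x

theorem ε_d (P : GrProjRes M) (x : (P.X 1).carrier) : P.ε (P.d 0 x) = 0 :=
  P.exact_zero.apply_apply_eq_zero x

theorem Hom.exists (P Q : GrProjRes M) : Nonempty (Hom P Q) := by
  obtain ⟨f₀, hf₀, hε⟩ := P.projective 0 (Q.X 0) M Q.ε P.ε Q.ε_graded Q.ε_surjective P.ε_graded
  -- Each `f` carries the fact that `f ∘ d` lands in the range of the differential of `Q`, which is
  -- what allows the next lift.
  obtain ⟨s, hs0, hs⟩ := exists_seq_of_forall_exists
    (α := fun n => {f : (P.X n).carrier →ₗ[R] (Q.X n).carrier // IsGrHom (P.X n) (Q.X n) f ∧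
      ∀ x, f (P.d n x) ∈ LinearMap.range (Q.d n)})
    (fun n f g => Q.d n ∘ₗ g.1 = f.1 ∘ₗ P.d n)
    ⟨f₀, hf₀, fun x => (Q.exact_zero _).1 (by
      rw [← LinearMap.comp_apply, hε, P.ε_d])⟩
    (by
      rintro n ⟨f, hf, hr⟩
      obtain ⟨g, hg, hgf⟩ := (P.projective (n + 1)).exists_lift (Q.d_graded n) (g := f ∘ₗ P.d n)
        (fun i m hm => hf i _ (P.d_graded n i m hm)) hr
      refine ⟨⟨g, hg, fun x => (Q.exact_succ n _).1 ?_⟩, hgf⟩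
      rw [← LinearMap.comp_apply, hgf, LinearMap.comp_apply, P.d_d, map_zero])
  exact ⟨⟨fun n => (s n).1, fun n => (s n).2.1, by rw [hs0, hε], hs⟩⟩

/-- Two morphisms of graded resolutions are homotopic. -/
theorem Hom.exists_homotopy {P Q : GrProjRes M} (φ ψ : Hom P Q) :
    ∃ s : ∀ n, (P.X n).carrier →ₗ[R] (Q.X (n + 1)).carrier,
      (∀ n, IsGrHom (P.X n) (Q.X (n + 1)) (s n)) ∧
      φ.f 0 - ψ.f 0 = Q.d 0 ∘ₗ s 0 ∧
      ∀ n, φ.f (n + 1) - ψ.f (n + 1) = Q.d (n + 1) ∘ₗ s (n + 1) + s n ∘ₗ P.d n := by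
  have hD : ∀ n x, Q.d n (φ.f (n + 1) x - ψ.f (n + 1) x)
      = φ.f n (P.d n x) - ψ.f n (P.d n x) := fun n x => by
    have h1 := LinearMap.congr_fun (φ.comm n) x
    have h2 := LinearMap.congr_fun (ψ.comm n) x
    simp only [LinearMap.comp_apply] at h1 h2
    rw [map_sub, h1, h2]
  have hg : ∀ n, IsGrHom (P.X n) (Q.X n) (φ.f n - ψ.f n) := fun n i m hm =>
    sub_mem (φ.graded n i m hm) (ψ.graded n i m hm)
  obtain ⟨s₀, hs₀, hds₀⟩ := (P.projective 0).exists_lift (Q.d_graded 0) (hg 0)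
    (fun x => (Q.exact_zero _).1 (by
      have h1 := LinearMap.congr_fun φ.comm_ε x
      have h2 := LinearMap.congr_fun ψ.comm_ε x
      simp only [LinearMap.comp_apply] at h1 h2
      rw [LinearMap.sub_apply, map_sub, h1, h2, sub_self]))
  -- The invariant is that `φ - ψ - s d` in the next degree takes values in boundaries of `Q`; the
  -- next piece of the homotopy is a lift of this map.
  obtain ⟨s, hs0, hs⟩ := exists_seq_of_forall_exists
    (α := fun n => {s : (P.X n).carrier →ₗ[R] (Q.X (n + 1)).carrier //
      IsGrHom (P.X n) (Q.X (n + 1)) s ∧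
      ∀ x, (φ.f (n + 1) - ψ.f (n + 1) - s ∘ₗ P.d n) x ∈ LinearMap.range (Q.d (n + 1))})
    (fun n s t => Q.d (n + 1) ∘ₗ t.1 = φ.f (n + 1) - ψ.f (n + 1) - s.1 ∘ₗ P.d n)
    ⟨s₀, hs₀, fun x => (Q.exact_succ 0 _).1 (by
      have h := LinearMap.congr_fun hds₀ (P.d 0 x)
      simp only [LinearMap.comp_apply, LinearMap.sub_apply] at h
      simp only [LinearMap.comp_apply, LinearMap.sub_apply]
      rw [map_sub, hD, h, sub_self])⟩
    (by
      rintro n ⟨s, hs, hr⟩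
      obtain ⟨t, ht, hts⟩ := (P.projective (n + 1)).exists_lift (Q.d_graded (n + 1))
        (g := φ.f (n + 1) - ψ.f (n + 1) - s ∘ₗ P.d n)
        (fun i m hm => sub_mem (hg (n + 1) i m hm) (hs i _ (P.d_graded n i m hm))) hr
      refine ⟨⟨t, ht, fun x => (Q.exact_succ (n + 1) _).1 ?_⟩, hts⟩
      have h := LinearMap.congr_fun hts (P.d (n + 1) x)
      simp only [LinearMap.comp_apply, LinearMap.sub_apply, P.d_d, map_zero, sub_zero] at h
      simp only [LinearMap.comp_apply, LinearMap.sub_apply]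
      rw [map_sub, hD, h, sub_self])
  refine ⟨fun n => (s n).1, fun n => (s n).2.1, ?_, fun n => ?_⟩
  · change _ = Q.d 0 ∘ₗ (s 0).1
    rw [hs0, hds₀]
  · rw [hs n, sub_add_cancel]

theorem Hom.precomp_mem_cocycles {P Q : GrProjRes M} (φ : Hom P Q) (n : ℕ)
    (f : (Q.X n).carrier →ₗ[R] R) (hf : f ∈ Q.cocycles n) :
    precomp (φ.f n) f ∈ P.cocycles n := by
  refine ⟨precomp_mem_totalHom (φ.graded n) hf.1, ?_⟩
  have h : f ∘ₗ Q.d n = 0 := LinearMap.mem_ker.1 hf.2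
  change (f ∘ₗ φ.f n) ∘ₗ P.d n = 0
  rw [LinearMap.comp_assoc, ← φ.comm, ← LinearMap.comp_assoc, h, LinearMap.zero_comp]

theorem Hom.precomp_mem_coboundaries {P Q : GrProjRes M} (φ : Hom P Q) (n : ℕ)
    (f : (Q.X n).carrier →ₗ[R] R) (hf : f ∈ Q.coboundaries n) :
    precomp (φ.f n) f ∈ P.coboundaries n := by
  cases n with
  | zero =>
    rw [show f = 0 from hf, map_zero]
    exact zero_mem _
  | succ n =>
    obtain ⟨g, hg, rfl⟩ := hf
    refine ⟨precomp (φ.f n) g, precomp_mem_totalHom (φ.graded n) hg, ?_⟩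
    change (g ∘ₗ φ.f n) ∘ₗ P.d n = (g ∘ₗ Q.d n) ∘ₗ φ.f (n + 1)
    rw [LinearMap.comp_assoc, ← φ.comm, LinearMap.comp_assoc]

/-- The map on cohomology induced by a morphism of resolutions. -/
def Hom.cohomologyMap {P Q : GrProjRes M} (φ : Hom P Q) (n : ℕ) :
    Q.cohomology n →ₗ[Rᵐᵒᵖ] P.cohomology n :=
  Subquotient.map (precomp (φ.f n)) (φ.precomp_mem_cocycles n) (φ.precomp_mem_coboundaries n)

theorem Hom.cohomologyMap_mem {P Q : GrProjRes M} (φ : Hom P Q) {n : ℕ} {τ : G}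
    {x : Q.cohomology n} (hx : x ∈ Q.cohomologyDeg n τ) :
    φ.cohomologyMap n x ∈ P.cohomologyDeg n τ := by
  obtain ⟨z, hz, rfl⟩ := hx
  exact ⟨_, precomp_mem_homDeg (φ.graded n) hz, rfl⟩

/-- The identity morphism of a graded resolution. -/
def Hom.id (P : GrProjRes M) : Hom P P where
  f _ := LinearMap.id
  graded _ _ _ hm := hm
  comm_ε := rfl
  comm _ := rfl

/-- The composite of morphisms of graded resolutions. -/
def Hom.comp {P Q T : GrProjRes M} (ψ : Hom Q T) (φ : Hom P Q) : Hom P T where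
  f n := ψ.f n ∘ₗ φ.f n
  graded n i m hm := ψ.graded n i _ (φ.graded n i m hm)
  comm_ε := by rw [← LinearMap.comp_assoc, ψ.comm_ε, φ.comm_ε]
  comm n := by
    rw [← LinearMap.comp_assoc, ψ.comm, LinearMap.comp_assoc, φ.comm, LinearMap.comp_assoc]

/-- All morphisms between two resolutions induce the same map on cohomology. -/
theorem Hom.cohomologyMap_eq {P Q : GrProjRes M} (φ ψ : Hom P Q) (n : ℕ) :
    φ.cohomologyMap n = ψ.cohomologyMap n := by
  obtain ⟨s, hs, h0, hsucc⟩ := φ.exists_homotopy ψ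
  ext x
  obtain ⟨z, rfl⟩ := Subquotient.mk_surjective _ _ x
  refine Subquotient.mk_eq_iff.2 ?_
  have hz : z.1 ∘ₗ Q.d n = 0 := LinearMap.mem_ker.1 z.2.2
  change z.1 ∘ₗ φ.f n - z.1 ∘ₗ ψ.f n ∈ _
  rw [← LinearMap.comp_sub]
  -- By the homotopy, `z (φ - ψ) = z d s + z s d`. The first term vanishes since `z` is a cocycle.
  -- The second is a coboundary because `s` is graded, so `z s` stays in the total HOM; in degree
  -- zero it is absent.
  cases n with
  | zero =>
    rw [h0, ← LinearMap.comp_assoc, hz, LinearMap.zero_comp]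
    exact zero_mem _
  | succ n =>
    rw [hsucc, LinearMap.comp_add, ← LinearMap.comp_assoc, hz, LinearMap.zero_comp, zero_add,
      ← LinearMap.comp_assoc]
    exact ⟨precomp (s n) z.1, precomp_mem_totalHom (hs n) z.2.1, rfl⟩

/-- The cohomology does not depend on the resolution. -/
theorem exists_cohomology_equiv (P Q : GrProjRes M) (n : ℕ) :
    ∃ e : P.cohomology n ≃ₗ[Rᵐᵒᵖ] Q.cohomology n,
      ∀ τ x, x ∈ P.cohomologyDeg n τ ↔ e x ∈ Q.cohomologyDeg n τ := by
  obtain ⟨φ⟩ := Hom.exists P Q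
  obtain ⟨ψ⟩ := Hom.exists Q P
  -- The composite `ψ φ` and the identity both lie over the identity of `M`, so they induce the same
  -- map on cohomology.
  have h1 : ∀ x, φ.cohomologyMap n (ψ.cohomologyMap n x) = x := fun x => by
    have h : (ψ.comp φ).cohomologyMap n x = (Hom.id P).cohomologyMap n x := by
      rw [Hom.cohomologyMap_eq]
    obtain ⟨z, rfl⟩ := Subquotient.mk_surjective _ _ x
    exact h
  have h2 : ∀ x, ψ.cohomologyMap n (φ.cohomologyMap n x) = x := fun x => by
    have h : (φ.comp ψ).cohomologyMap n x = (Hom.id Q).cohomologyMap n x := by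
      rw [Hom.cohomologyMap_eq]
    obtain ⟨z, rfl⟩ := Subquotient.mk_surjective _ _ x
    exact h
  refine ⟨LinearEquiv.ofLinearMap (ψ.cohomologyMap n) (φ.cohomologyMap n) (LinearMap.ext h2)
    (LinearMap.ext h1), fun τ x => ⟨ψ.cohomologyMap_mem, fun hx => ?_⟩⟩
  rw [← h1 x]
  exact φ.cohomologyMap_mem hx

end GrProjRes

end Comparison

/-! ### Projective resolutions of modules from exact sequences of linear maps -/

section Resolution

open CategoryTheory

variable {R : Type v} [Ring R]

/-- The chain complex of a sequence of linear maps with vanishing composites. -/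
def seqComplex (X : ℕ → Type v) [∀ n, AddCommGroup (X n)] [∀ n, Module R (X n)]
    (d : ∀ n, X (n + 1) →ₗ[R] X n) (hd : ∀ n, d n ∘ₗ d (n + 1) = 0) :
    ChainComplex (ModuleCat.{v} R) ℕ :=
  ChainComplex.of (fun n => ModuleCat.of R (X n)) (fun n => ModuleCat.ofHom (d n))
    (fun n => by rw [← ModuleCat.ofHom_comp, hd]; rfl)

variable {X : ℕ → Type v} [∀ n, AddCommGroup (X n)] [∀ n, Module R (X n)]
    {d : ∀ n, X (n + 1) →ₗ[R] X n}

theorem seqComplex_d (hd : ∀ n, d n ∘ₗ d (n + 1) = 0) (n : ℕ) :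
    (seqComplex X d hd).d (n + 1) n = ModuleCat.ofHom (d n) :=
  ChainComplex.of_d (fun n => ModuleCat.of R (X n)) (fun n => ModuleCat.ofHom (d n)) n

theorem seqComplex_exactAt_succ (hd : ∀ n, d n ∘ₗ d (n + 1) = 0)
    (hex : ∀ n, Function.Exact (d (n + 1)) (d n)) (n : ℕ) :
    (seqComplex X d hd).ExactAt (n + 1) := by
  rw [HomologicalComplex.exactAt_iff' _ (n + 1 + 1) (n + 1) n (by simp) (by simp),
    ShortComplex.ShortExact.moduleCat_exact_iff_function_exact]
  change Function.Exact ((seqComplex X d hd).d (n + 1 + 1) (n + 1)) ((seqComplex X d hd).d (n + 1) n)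
  rw [seqComplex_d, seqComplex_d]
  exact hex n

/-- The augmentation of the chain complex of a sequence of linear maps. -/
def seqAugmentation (hd : ∀ n, d n ∘ₗ d (n + 1) = 0) {M : Type v} [AddCommGroup M] [Module R M]
    (ε : X 0 →ₗ[R] M) (hε : ε ∘ₗ d 0 = 0) :
    seqComplex X d hd ⟶ (ChainComplex.single₀ _).obj (ModuleCat.of R M) :=
  (ChainComplex.toSingle₀Equiv _ _).symm ⟨ModuleCat.ofHom ε, by
    rw [seqComplex_d]
    exact ModuleCat.hom_ext hε⟩

theorem seqAugmentation_f_zero (hd : ∀ n, d n ∘ₗ d (n + 1) = 0) {M : Type v} [AddCommGroup M]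
    [Module R M] (ε : X 0 →ₗ[R] M) (hε : ε ∘ₗ d 0 = 0) :
    (seqAugmentation hd ε hε).f 0 = ModuleCat.ofHom ε :=
  ChainComplex.toSingle₀Equiv_symm_apply_f_zero (C := seqComplex X d hd) (X := ModuleCat.of R M)
    (ModuleCat.ofHom ε) _

/-- An exact sequence of projective modules ending in `M` as a projective resolution. -/
def projectiveResolutionOfExact {M : Type v} [AddCommGroup M] [Module R M] (ε : X 0 →ₗ[R] M)
    (hP : ∀ n, Module.Projective R (X n)) (hs : Function.Surjective ε)
    (h0 : Function.Exact (d 0) ε) (hex : ∀ n, Function.Exact (d (n + 1)) (d n)) :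
    ProjectiveResolution (ModuleCat.of R M) where
  complex := seqComplex X d fun n => (hex n).linearMap_comp_eq_zero
  projective n := (IsProjective.iff_projective (R := R) (X n)).1 (hP n)
  π := seqAugmentation _ ε h0.linearMap_comp_eq_zero
  quasiIso := ⟨fun n => by
    -- In degree zero the condition says that `X 1 → X 0 → M → 0` is exact; in positive degrees the
    -- target has no homology and exactness of the complex is all that is required.
    cases n
    · rw [ChainComplex.quasiIsoAt₀_iff, ShortComplex.quasiIso_iff_of_zeros']
      · have hz : ModuleCat.ofHom (d 0) ≫ ModuleCat.ofHom ε = 0 :=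
          ModuleCat.hom_ext h0.linearMap_comp_eq_zero
        have he : (ShortComplex.mk _ _ hz).Exact ∧ Epi (ModuleCat.ofHom ε) :=
          ⟨(ShortComplex.ShortExact.moduleCat_exact_iff_function_exact _).2 h0,
            (ModuleCat.epi_iff_surjective _).2 hs⟩
        refine (ShortComplex.exact_and_epi_g_iff_of_iso ?_).2 he
        exact ShortComplex.isoMk (Iso.refl _) (Iso.refl _) (Iso.refl _)
          ((Category.id_comp _).trans ((seqComplex_d (fun n => (hex n).linearMap_comp_eq_zero) 0).symm.trans (Category.comp_id _).symm))
          ((Category.id_comp _).trans ((seqAugmentation_f_zero _ ε h0.linearMap_comp_eq_zero).symm.trans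
            (Category.comp_id _).symm))
      all_goals rfl
    · rw [quasiIsoAt_iff_exactAt']
      · exact seqComplex_exactAt_succ _ hex _
      · apply ChainComplex.exactAt_succ_single_obj⟩

end Resolution

/-! ### Vanishing of Ext classes in degree zero -/

section ExtZero

open CategoryTheory CochainComplex.HomComplex Abelian

variable {C : Type u} [Category.{v} C] [Abelian C] [HasExt.{w} C]
  {X Y : C} (P : ProjectiveResolution X)

/-- There are no coboundaries in degree zero: a cochain bounding `f` would start from degree one of
the cochain complex of the resolution, which is zero. -/
theorem extMk_zero_eq_zero_iff (f : P.complex.X 0 ⟶ Y) (hf : P.complex.d 1 0 ≫ f = 0) :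
    P.extMk f 1 rfl hf = 0 ↔ f = 0 := by
  simp only [← P.extEquivCohomologyClass.apply_eq_iff_eq,
    ProjectiveResolution.extEquivCohomologyClass_extMk,
    ProjectiveResolution.extEquivCohomologyClass_zero, CohomologyClass.mk_eq_zero_iff]
  rw [Cocycle.toSingleMk_mem_coboundaries_iff _ _ _ _ _ 1 (by simp)]
  have hz : Limits.IsZero (P.cochainComplex.X 1) :=
    CochainComplex.isZero_of_isStrictlyLE _ 0 _ (by simp)
  constructor
  · rintro ⟨g, hg⟩
    rw [hz.eq_of_src g 0, Limits.comp_zero] at hg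
    rw [← cancel_epi (P.cochainComplexXIso (-(0 : ℕ)) 0 rfl).hom, ← hg, Limits.comp_zero]
  · rintro rfl
    exact ⟨0, by simp⟩

end ExtZero

/-! ### `Ext` through a graded resolution by finitely generated modules -/

section ExtComparison

open CategoryTheory

variable {k : Type u} [Field k] {G : Type w} [AddCommGroup G] [DecidableEq G]
variable {R : Type v} [Ring R] [Algebra k R] {𝓡 : G → Submodule k R} [GradedAlgebra 𝓡]
variable {M : GrMod 𝓡}

namespace GrProjRes

/-- The projective resolution underlying a graded resolution. -/
def toProjectiveResolution (P : GrProjRes M) : ProjectiveResolution (ModuleCat.of R M.carrier) :=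
  projectiveResolutionOfExact (X := fun n => (P.X n).carrier) (d := P.d) P.ε
    (fun n => (P.projective n).projective) P.ε_surjective P.exact_zero P.exact_succ

variable (P : GrProjRes M)

theorem toProjectiveResolution_d (n : ℕ) :
    P.toProjectiveResolution.complex.d (n + 1) n = ModuleCat.ofHom (P.d n) :=
  seqComplex_d (fun n => (P.exact_succ n).linearMap_comp_eq_zero) n

/-- A homomorphism into the algebra as a morphism out of the underlying resolution. -/
def cochain {n : ℕ} (f : (P.X n).carrier →ₗ[R] R) :
    P.toProjectiveResolution.complex.X n ⟶ ModuleCat.of R R :=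
  ModuleCat.ofHom f

theorem d_comp_cochain {n : ℕ} {f : (P.X n).carrier →ₗ[R] R} (hf : f ∈ P.cocycles n) :
    P.toProjectiveResolution.complex.d (n + 1) n ≫ P.cochain f = 0 := by
  rw [toProjectiveResolution_d]
  exact ModuleCat.hom_ext (LinearMap.mem_ker.1 hf.2)

/-- The class in `Ext` of a cocycle. -/
def extClass (n : ℕ) : P.cocycles n →ₗ[Rᵐᵒᵖ] ExtR (ModuleCat.of R M.carrier) n where
  toFun z := P.toProjectiveResolution.extMk (P.cochain z.1) (n + 1) rfl (P.d_comp_cochain z.2)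
  map_add' y z := (P.toProjectiveResolution.add_extMk (P.cochain y.1) (P.cochain z.1) (n + 1) rfl
    (P.d_comp_cochain y.2) (P.d_comp_cochain z.2)).symm
  map_smul' r z := (P.toProjectiveResolution.extMk_comp_mk₀ (P.cochain z.1) (n + 1) rfl
    (P.d_comp_cochain z.2) (rightMul r.unop)).symm

/-- Every Ext class has an ungraded cocycle representing it, and finite generation places that
cocycle in the total HOM. -/
theorem extClass_surjective (hP : ∀ n, Module.Finite R (P.X n).carrier) (n : ℕ) :
    Function.Surjective (P.extClass n) := by
  intro x
  obtain ⟨f, hf, rfl⟩ := P.toProjectiveResolution.extMk_surjective x (n + 1) rfl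
  have hP := hP n
  refine ⟨⟨f.hom, ?_, ?_⟩, rfl⟩
  · rw [totalHom_eq_top]
    exact Submodule.mem_top
  · rw [toProjectiveResolution_d] at hf
    exact congrArg ModuleCat.Hom.hom hf

/-- A vanishing class has an ungraded primitive; finite generation of the preceding term places this
primitive in the total HOM. Degree zero has no preceding term and is treated apart. -/
theorem extClass_eq_zero_iff (hP : ∀ n, Module.Finite R (P.X n).carrier) (n : ℕ)
    (z : P.cocycles n) : P.extClass n z = 0 ↔ z.1 ∈ P.coboundaries n := by
  cases n with
  | zero =>
    refine (extMk_zero_eq_zero_iff P.toProjectiveResolution (P.cochain z.1) (P.d_comp_cochain z.2)).trans ?_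
    exact ⟨fun h => congrArg ModuleCat.Hom.hom h, fun h => ModuleCat.hom_ext h⟩
  | succ n =>
    refine (ProjectiveResolution.extMk_eq_zero_iff P.toProjectiveResolution (P.cochain z.1) _ rfl
      (P.d_comp_cochain z.2) n rfl).trans ?_
    rw [toProjectiveResolution_d]
    constructor
    · rintro ⟨g, hg⟩
      have hP := hP n
      refine ⟨g.hom, ?_, congrArg ModuleCat.Hom.hom hg⟩
      rw [totalHom_eq_top]
      exact Submodule.mem_top
    · rintro ⟨g, -, hg⟩
      exact ⟨ModuleCat.ofHom g, ModuleCat.hom_ext hg⟩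

/-- For a resolution by finitely generated modules, graded and ungraded `Ext` agree. -/
theorem exists_cohomology_equiv_ext (hP : ∀ n, Module.Finite R (P.X n).carrier) (n : ℕ) :
    Nonempty (P.cohomology n ≃ₗ[Rᵐᵒᵖ] ExtR (ModuleCat.of R M.carrier) n) := by
  have hker : (P.coboundaries n).submoduleOf (P.cocycles n) = LinearMap.ker (P.extClass n) := by
    ext z
    rw [LinearMap.mem_ker, P.extClass_eq_zero_iff hP]
    rfl
  exact ⟨(Submodule.quotEquivOfEq _ _ hker).trans
    ((P.extClass n).quotKerEquivOfSurjective (P.extClass_surjective hP n))⟩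

end GrProjRes

end ExtComparison

/-! ### Finite resolutions by finitely generated projective modules -/

section FiniteResolutions

variable (R : Type v) [Ring R]

/-- `M` has a resolution of length `n` by finitely generated projective modules. -/
def HasFiniteResolution : ℕ → ∀ (M : Type v) [AddCommGroup M] [Module R M], Prop
  | 0, M, _, _ => Module.Finite R M ∧ Module.Projective R M
  | n + 1, M, _, _ => ∃ (K F : Type v) (_ : AddCommGroup K) (_ : Module R K) (_ : AddCommGroup F)
      (_ : Module R F) (i : K →ₗ[R] F) (p : F →ₗ[R] M), Module.Finite R F ∧
      Module.Projective R F ∧ Function.Injective i ∧ Function.Exact i p ∧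
      Function.Surjective p ∧ HasFiniteResolution n K

variable {R}
variable {K L F M M' : Type v} [AddCommGroup K] [Module R K] [AddCommGroup L] [Module R L]
  [AddCommGroup F] [Module R F] [AddCommGroup M] [Module R M] [AddCommGroup M'] [Module R M']

theorem HasFiniteResolution.finite {n : ℕ} (h : HasFiniteResolution R n M) :
    Module.Finite R M := by
  cases n with
  | zero => exact h.1
  | succ n =>
    obtain ⟨K, F, _, _, _, _, i, p, hf, -, -, -, hp, -⟩ := h
    exact Module.Finite.of_surjective p hp

theorem HasFiniteResolution.equiv {n : ℕ} (h : HasFiniteResolution R n M) (e : M ≃ₗ[R] M') :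
    HasFiniteResolution R n M' := by
  cases n with
  | zero =>
    have := h.1
    have := h.2
    exact ⟨Module.Finite.equiv e, Module.Projective.of_equiv e⟩
  | succ n =>
    obtain ⟨K, F, _, _, _, _, i, p, hf, hF, hi, hip, hp, hK⟩ := h
    refine ⟨K, F, _, _, _, _, i, e.toLinearMap ∘ₗ p, hf, hF, hi, fun x => ?_,
      e.surjective.comp hp, hK⟩
    rw [← hip x]
    simp

/-- Adding `F` to the first term of the resolution leaves the kernel unchanged. -/
theorem HasFiniteResolution.prod {n : ℕ} (h : HasFiniteResolution R n M) [Module.Finite R F]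
    [Module.Projective R F] : HasFiniteResolution R n (M × F) := by
  cases n with
  | zero =>
    have := h.1
    have := h.2
    exact ⟨inferInstance, inferInstance⟩
  | succ n =>
    obtain ⟨K, P, _, _, _, _, i, p, hf, hP, hi, hip, hp, hK⟩ := h
    refine ⟨K, P × F, _, _, _, _, LinearMap.inl R P F ∘ₗ i, p.prodMap LinearMap.id,
      inferInstance, inferInstance, LinearMap.inl_injective.comp hi, ?_,
      hp.prodMap Function.surjective_id, hK⟩
    rintro ⟨x, y⟩
    simp only [LinearMap.prodMap_apply, LinearMap.id_apply, Prod.mk_eq_zero, hip x,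
      Set.mem_range, LinearMap.comp_apply, LinearMap.inl_apply, Prod.mk.injEq]
    exact ⟨fun ⟨⟨z, hz⟩, hy⟩ => ⟨z, hz, hy.symm⟩, fun ⟨z, hz, hy⟩ => ⟨⟨z, hz⟩, hy.symm⟩⟩

/-- A short exact sequence with projective quotient splits. -/
theorem nonempty_equiv_prod_of_exact [Module.Projective R F] {i : K →ₗ[R] L} {p : L →ₗ[R] F}
    (hi : Function.Injective i) (hip : Function.Exact i p) (hp : Function.Surjective p) :
    Nonempty (L ≃ₗ[R] K × F) := by
  obtain ⟨s, hs⟩ := Module.projective_lifting_property p LinearMap.id hp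
  exact ⟨(hip.splitSurjectiveEquiv hi ⟨s, hs⟩).1⟩

/-- Let `P` cover `M × F` with kernel `K`, and let `L` be the kernel of the composite `P → M`. Then
`L` maps onto `F` with kernel `K`, so `L ≃ K × F`, and `HasFiniteResolution.prod` resolves `L`. -/
theorem HasFiniteResolution.of_prod {n : ℕ} (h : HasFiniteResolution R n (M × F))
    [Module.Finite R F] [Module.Projective R F] : HasFiniteResolution R n M := by
  cases n with
  | zero =>
    have := h.1
    have := h.2
    exact ⟨Module.Finite.of_surjective (LinearMap.fst R M F) LinearMap.fst_surjective,
      Module.Projective.of_split (LinearMap.inl R M F) (LinearMap.fst R M F)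
        (LinearMap.fst_comp_inl R M F)⟩
  | succ n =>
    obtain ⟨K, P, _, _, _, _, i, p, hf, hP, hi, hip, hp, hK⟩ := h
    let L := LinearMap.ker (LinearMap.fst R M F ∘ₗ p)
    have hiL : ∀ x, i x ∈ L := fun x => by
      simp [L, hip.apply_apply_eq_zero x]
    obtain ⟨e⟩ := nonempty_equiv_prod_of_exact (i := i.codRestrict L hiL)
      (p := LinearMap.snd R M F ∘ₗ p ∘ₗ L.subtype)
      (fun x y hxy => hi (congrArg Subtype.val hxy))
      (fun x => by
        have hx : (p x.1).1 = 0 := x.2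
        have : (LinearMap.snd R M F ∘ₗ p ∘ₗ L.subtype) x = 0 ↔ p x.1 = 0 := by
          rw [Prod.ext_iff]
          simp [hx]
        rw [this, hip x.1]
        exact ⟨fun ⟨y, hy⟩ => ⟨y, Subtype.ext hy⟩, fun ⟨y, hy⟩ => ⟨y, congrArg Subtype.val hy⟩⟩)
      (fun y => by
        obtain ⟨x, hx⟩ := hp (0, y)
        exact ⟨⟨x, by simp [L, hx]⟩, by simp [hx]⟩)
    exact ⟨L, P, _, _, _, _, L.subtype, LinearMap.fst R M F ∘ₗ p, hf, hP, L.injective_subtype,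
      LinearMap.exact_subtype_ker_map _,
      (LinearMap.fst_surjective (R := R) (M := M) (M₂ := F)).comp hp, hK.prod.equiv e.symm⟩

/-- Schanuel's lemma. -/
theorem schanuel {K' F' : Type v} [AddCommGroup K'] [Module R K'] [AddCommGroup F'] [Module R F']
    [Module.Projective R F] [Module.Projective R F'] {i : K →ₗ[R] F} {p : F →ₗ[R] M}
    {i' : K' →ₗ[R] F'} {p' : F' →ₗ[R] M} (hi : Function.Injective i) (hip : Function.Exact i p)
    (hp : Function.Surjective p) (hi' : Function.Injective i') (hip' : Function.Exact i' p')
    (hp' : Function.Surjective p') : Nonempty ((K × F') ≃ₗ[R] (K' × F)) := by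
  -- `Q` is the fibre product of `F` and `F'` over `M`. It maps onto `F'` with kernel `K` and onto
  -- `F` with kernel `K'`, and both surjections split.
  let Q := LinearMap.ker (p.coprod (-p'))
  have hQ : ∀ x : F × F', x ∈ Q ↔ p x.1 = p' x.2 := fun x => by
    simp [Q, ← sub_eq_add_neg, sub_eq_zero]
  obtain ⟨e⟩ := nonempty_equiv_prod_of_exact
    (i := (LinearMap.inl R F F' ∘ₗ i).codRestrict Q fun x => by
      simp [hQ, hip.apply_apply_eq_zero])
    (p := LinearMap.snd R F F' ∘ₗ Q.subtype)
    (fun x y hxy => hi (congrArg (fun z => z.1.1) hxy))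
    (by
      rintro ⟨⟨x, y⟩, hxy⟩
      rw [hQ] at hxy
      constructor
      · intro hy
        have hy : y = 0 := hy
        subst hy
        obtain ⟨z, hz⟩ := (hip x).1 (by simpa using hxy)
        exact ⟨z, Subtype.ext (Prod.ext hz rfl)⟩
      · rintro ⟨z, hz⟩
        exact (congrArg (fun z => z.1.2) hz).symm)
    (fun y => by
      obtain ⟨x, hx⟩ := hp (p' y)
      exact ⟨⟨(x, y), (hQ _).2 hx⟩, rfl⟩)
  obtain ⟨e'⟩ := nonempty_equiv_prod_of_exact
    (i := (LinearMap.inr R F F' ∘ₗ i').codRestrict Q fun x => by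
      simp [hQ, hip'.apply_apply_eq_zero])
    (p := LinearMap.fst R F F' ∘ₗ Q.subtype)
    (fun x y hxy => hi' (congrArg (fun z => z.1.2) hxy))
    (by
      rintro ⟨⟨x, y⟩, hxy⟩
      rw [hQ] at hxy
      constructor
      · intro hx
        have hx : x = 0 := hx
        subst hx
        obtain ⟨z, hz⟩ := (hip' y).1 (by simpa using hxy.symm)
        exact ⟨z, Subtype.ext (Prod.ext rfl hz)⟩
      · rintro ⟨z, hz⟩
        exact (congrArg (fun z => z.1.1) hz).symm)
    (fun x => by
      obtain ⟨y, hy⟩ := hp' (p x)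
      exact ⟨⟨(x, y), (hQ _).2 hy.symm⟩, rfl⟩)
  exact ⟨e.symm.trans e'⟩

/-- Schanuel's lemma gives `K × F ≃ ker p × P` for the cover `P` with kernel `K` in the given
resolution. Hence the cover may be chosen freely, in particular graded. -/
theorem HasFiniteResolution.ker {n : ℕ} (h : HasFiniteResolution R (n + 1) M)
    [Module.Finite R F] [Module.Projective R F] {p : F →ₗ[R] M} (hp : Function.Surjective p) :
    HasFiniteResolution R n (LinearMap.ker p) := by
  obtain ⟨K, P, _, _, _, _, i, q, hf, hP, hi, hiq, hq, hK⟩ := h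
  obtain ⟨e⟩ := schanuel hi hiq hq (LinearMap.ker p).injective_subtype
    (LinearMap.exact_subtype_ker_map p) hp
  exact (hK.prod.equiv e).of_prod

/-- The range of `d n` is covered by `X (n + 1)` with kernel the range of `d (n + 1)`. After `m`
such steps the bound `N ≤ n + m` makes the remaining range zero. -/
theorem hasFiniteResolution_range {X : ℕ → Type v} [∀ n, AddCommGroup (X n)]
    [∀ n, Module R (X n)] {d : ∀ n, X (n + 1) →ₗ[R] X n}
    (hP : ∀ n, Module.Projective R (X n)) (hF : ∀ n, Module.Finite R (X n))
    (hex : ∀ n, Function.Exact (d (n + 1)) (d n)) {N : ℕ} (hN : ∀ n, N < n → Subsingleton (X n))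
    (m n : ℕ) (hmn : N ≤ n + m) : HasFiniteResolution R m (LinearMap.range (d n)) := by
  induction m generalizing n with
  | zero =>
    have := hN (n + 1) (by omega)
    have : Subsingleton (LinearMap.range (d n)) :=
      (d n).surjective_rangeRestrict.subsingleton
    exact ⟨inferInstance, inferInstance⟩
  | succ m ih =>
    refine ⟨LinearMap.range (d (n + 1)), X (n + 1), _, _, _, _, Submodule.subtype _,
      (d n).rangeRestrict, hF _, hP _, Submodule.injective_subtype _, fun x => ?_,
      (d n).surjective_rangeRestrict, ih (n + 1) (by omega)⟩
    have : (d n).rangeRestrict x = 0 ↔ d n x = 0 := Subtype.ext_iff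
    rw [this, hex n x]
    simp

end FiniteResolutions

/-! ### Finite graded resolutions from ungraded ones -/

section GradedFiniteResolutions

open CategoryTheory

/-- The length is `N + 1` because the range of `d N`, which is zero, is counted as the last module.
Only finiteness matters. -/
theorem hasFiniteResolution_of_projectiveResolution {R : Type v} [Ring R] {M : ModuleCat.{v} R}
    (P : ProjectiveResolution M) (hF : ∀ n, Module.Finite R (P.complex.X n)) {N : ℕ}
    (hN : ∀ n, N < n → Limits.IsZero (P.complex.X n)) : HasFiniteResolution R (N + 1) M := by
  have hP : ∀ n, Module.Projective R (P.complex.X n) := fun n =>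
    (IsProjective.iff_projective (R := R) _).2 (P.projective n)
  refine ⟨_, P.complex.X 0, _, _, _, _,
    Submodule.subtype (LinearMap.range (P.complex.d 1 0).hom), (P.π.f 0).hom, hF 0, hP 0,
    Submodule.injective_subtype _, fun x => ?_,
    (ModuleCat.epi_iff_surjective (P.π.f 0)).1 inferInstance,
    hasFiniteResolution_range (d := fun n => (P.complex.d (n + 1) n).hom) hP hF
      (fun n => (ShortComplex.ShortExact.moduleCat_exact_iff_function_exact _).1 (P.exact_succ n))
      (fun n hn => ModuleCat.subsingleton_of_isZero (hN n hn)) N 0 (by omega)⟩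
  refine ((ShortComplex.ShortExact.moduleCat_exact_iff_function_exact _).1 P.exact₀ x).trans ?_
  simp

variable {k : Type u} [Field k] {G : Type w} [AddCommGroup G] [DecidableEq G]
variable {R : Type v} [Ring R] [Algebra k R] {𝓡 : G → Submodule k R} [GradedAlgebra 𝓡]

/-- The resolution obtained from a graded projective cover and a resolution of its kernel. -/
def GrProjRes.splice {M F : GrMod 𝓡} (hF : IsGrProjective F) (p : F.carrier →ₗ[R] M.carrier)
    (hp : IsGrHom F M p) (hs : Function.Surjective p) (Q : GrProjRes (GrMod.ker p hp)) :
    GrProjRes M where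
  X n := Nat.casesOn n F Q.X
  d n := match n with
    | 0 => (LinearMap.ker p).subtype ∘ₗ Q.ε
    | n + 1 => Q.d n
  ε := p
  d_graded n := match n with
    | 0 => fun i m hm => Q.ε_graded i m hm
    | n + 1 => Q.d_graded n
  ε_graded := hp
  projective n := match n with
    | 0 => hF
    | n + 1 => Q.projective n
  ε_surjective := hs
  exact_zero x := by
    constructor
    · intro hx
      obtain ⟨y, hy⟩ := Q.ε_surjective ⟨x, hx⟩
      exact ⟨y, congrArg Subtype.val hy⟩
    · rintro ⟨y, rfl⟩
      exact (Q.ε y).2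
  exact_succ n := match n with
    | 0 => fun x => (Subtype.ext_iff.symm).trans (Q.exact_zero x)
    | n + 1 => Q.exact_succ n

/-- The zero graded module. -/
abbrev GrMod.zero (𝓡 : G → Submodule k R) [GradedAlgebra 𝓡] : GrMod 𝓡 :=
  GrMod.free 𝓡 PEmpty PEmpty.elim

/-- A graded module that is projective as a module is its own resolution. -/
def GrProjRes.self {M : GrMod 𝓡} (hM : IsGrProjective M) : GrProjRes M where
  X n := Nat.casesOn n M fun _ => GrMod.zero 𝓡
  d _ := 0
  ε := LinearMap.id
  d_graded _ _ _ _ := zero_mem _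
  ε_graded _ _ hm := hm
  projective n := match n with
    | 0 => hM
    | n + 1 => GrMod.free_isGrProjective _ _
  ε_surjective := Function.surjective_id
  exact_zero x := ⟨fun h => ⟨0, h.symm⟩, fun ⟨_, h⟩ => h.symm⟩
  exact_succ _ _ := ⟨fun _ => ⟨0, Subsingleton.elim (α := Π₀ _ : PEmpty, R) _ _⟩, fun _ => rfl⟩

/-- A graded module with a finite resolution by finitely generated projective modules has such
a resolution in the category of graded modules. -/
theorem exists_finite_grProjRes {n : ℕ} {M : GrMod 𝓡} (h : HasFiniteResolution R n M.carrier) :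
    ∃ P : GrProjRes M, (∀ n, Module.Finite R (P.X n).carrier) ∧
      ∃ N : ℕ, ∀ n, N < n → Subsingleton (P.X n).carrier := by
  induction n generalizing M with
  | zero =>
    have := h.1
    have := h.2
    refine ⟨GrProjRes.self (isGrProjective_of_projective M), fun n => ?_, 0, fun n hn => ?_⟩
    · cases n with
      | zero => exact h.1
      | succ n => exact inferInstanceAs (Module.Finite R (Π₀ _ : PEmpty, R))
    · cases n with
      | zero => omega
      | succ n => exact inferInstanceAs (Subsingleton (Π₀ _ : PEmpty, R))
  | succ n ih =>
    have := h.finite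
    obtain ⟨F, p, hF, hfin, hp, hs⟩ := M.exists_finite_cover
    have := hF.projective
    -- The kernel of the graded cover is graded, and its resolution is shorter by one although the
    -- cover is unrelated to the given resolution.
    obtain ⟨Q, hQ, N, hN⟩ := ih (M := GrMod.ker p hp) (h.ker hs)
    refine ⟨GrProjRes.splice hF p hp hs Q, fun n => ?_, N + 1, fun n hn => ?_⟩
    · cases n with
      | zero => exact hfin
      | succ n => exact hQ n
    · cases n with
      | zero => omega
      | succ n => exact hN n (by omega)

end GradedFiniteResolutions

/-! ### Invertible bimodules and Morita contexts -/

section Morita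

open MulOpposite

open scoped ModuleCat.Algebra

variable {k : Type u} [Field k] {A : Type v} [Ring A] [Algebra k A]

/-- The left action of the algebra on a bimodule. -/
def lmul (U : ModuleCat.{v} (Env k A)) : A →ₐ[k] Module.End k U :=
  (act U).comp Algebra.TensorProduct.includeLeft

/-- The right action of the algebra on a bimodule. -/
def rmul (U : ModuleCat.{v} (Env k A)) : Aᵐᵒᵖ →ₐ[k] Module.End k U :=
  (act U).comp Algebra.TensorProduct.includeRight

variable {U V : ModuleCat.{v} (Env k A)}

theorem lmul_apply (a : A) (u : U) : lmul U a u = (a ⊗ₜ 1 : Env k A) • u := rfl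

theorem rmul_apply (a : Aᵐᵒᵖ) (u : U) : rmul U a u = (1 ⊗ₜ a : Env k A) • u := rfl

theorem tmul_smul_eq (a : A) (b : Aᵐᵒᵖ) (u : U) :
    (a ⊗ₜ b : Env k A) • u = lmul U a (rmul U b u) := by
  rw [lmul_apply, rmul_apply, smul_smul]
  simp

theorem lmul_rmul (a : A) (b : Aᵐᵒᵖ) (u : U) :
    lmul U a (rmul U b u) = rmul U b (lmul U a u) := by
  simp [lmul_apply, rmul_apply, smul_smul]

theorem lmul_mul (a b : A) (u : U) : lmul U (a * b) u = lmul U a (lmul U b u) := by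
  rw [map_mul]
  rfl

theorem rmul_mul (a b : A) (u : U) : rmul U (op (a * b)) u = rmul U (op b) (rmul U (op a) u) := by
  rw [op_mul, map_mul]
  rfl

theorem lmul_one (u : U) : lmul U 1 u = u := by simp

theorem rmul_one (u : U) : rmul U (op 1) u = u := by simp

theorem rmul_add (a b : A) (u : U) :
    rmul U (op (a + b)) u = rmul U (op a) u + rmul U (op b) u := by
  rw [op_add, map_add, LinearMap.add_apply]

theorem rmul_sum {ι : Type*} (s : Finset ι) (f : ι → A) (u : U) :
    rmul U (op (∑ j ∈ s, f j)) u = ∑ j ∈ s, rmul U (op (f j)) u := by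
  rw [Finset.op_sum, map_sum, LinearMap.sum_apply]

theorem tmulA_balanced (u : U) (a : A) (v : V) :
    tmulA (rmul U (op a) u) v = tmulA u (lmul V a v) := by
  refine (Submodule.Quotient.eq (tensorRel U V)).2 (Submodule.subset_span ⟨u, a, v, rfl⟩)

@[elab_as_elim]
theorem tensorA_induction {p : tensorA U V → Prop} (x : tensorA U V)
    (tmul : ∀ u v, p (tmulA u v)) (add : ∀ x y, p x → p y → p (x + y)) : p x := by
  obtain ⟨t, rfl⟩ := Submodule.mkQ_surjective (tensorRel U V) x
  induction t using TensorProduct.induction_on with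
  | zero =>
    rw [← TensorProduct.zero_tmul U (0 : V)]
    exact tmul 0 0
  | tmul u v => exact tmul u v
  | add x y hx hy =>
    rw [map_add]
    exact add _ _ hx hy

/-- The linear map out of `U ⊗_A V` defined by a balanced bilinear map. -/
def tensorLift {W : Type*} [AddCommGroup W] [Module k W] (f : U →ₗ[k] V →ₗ[k] W)
    (hf : ∀ u a v, f (rmul U (op a) u) v = f u (lmul V a v)) : tensorA U V →ₗ[k] W :=
  (tensorRel U V).liftQ (TensorProduct.lift f) (by
    refine Submodule.span_le.2 ?_
    rintro _ ⟨u, a, v, rfl⟩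
    rw [SetLike.mem_coe, LinearMap.mem_ker, map_sub, TensorProduct.lift.tmul,
      TensorProduct.lift.tmul, sub_eq_zero]
    exact hf u a v)

/-- The scalar action through the enveloping algebra is that of the quotient; this makes the
pairings `k`-bilinear. -/
theorem algebraMap_smul_tensorA (c : k) (x : tensorA U V) :
    algebraMap k (Env k A) c • x = c • x := by
  change tensorAct U V (algebraMap k (Env k A) c) x = _
  rw [AlgHom.commutes]
  rfl

theorem algebraMap_env_smul (c : k) (a : A) : algebraMap k (Env k A) c • a = c • a := by
  have : algebraMap k (Env k A) c = algebraMap k A c ⊗ₜ op 1 := rfl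
  rw [this, env_smul, mul_one, Algebra.smul_def]

/-- The pairing defined by an isomorphism `U ⊗_A V ≃ A`. -/
def pair (e : tensorA U V ≃ₗ[Env k A] A) : U →ₗ[k] V →ₗ[k] A :=
  LinearMap.mk₂ k (fun u v => e (tmulA u v))
    (fun u u' v => by rw [tmulA_add_left, map_add])
    (fun c u v => by
      rw [tmulA_smul_left, ← algebraMap_smul_tensorA, map_smul, algebraMap_env_smul])
    (fun u v v' => by rw [tmulA_add_right, map_add])
    (fun c u v => by
      rw [tmulA_smul_right, ← algebraMap_smul_tensorA, map_smul, algebraMap_env_smul])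

section Pair

variable (e : tensorA U V ≃ₗ[Env k A] A)

theorem pair_apply (u : U) (v : V) : pair e u v = e (tmulA u v) := rfl

theorem pair_lmul (a : A) (u : U) (v : V) : pair e (lmul U a u) v = a * pair e u v := by
  have h := env_smul_tmulA (U := U) (V := V) a 1 u v
  have h1 : (1 ⊗ₜ op 1 : Env k A) • v = v := one_smul (Env k A) v
  rw [h1] at h
  rw [pair_apply, lmul_apply, ← h, map_smul, env_smul, mul_one, pair_apply]

theorem pair_rmul (u : U) (v : V) (b : A) : pair e u (rmul V (op b) v) = pair e u v * b := by
  have h := env_smul_tmulA (U := U) (V := V) 1 b u v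
  have h1 : (1 ⊗ₜ 1 : Env k A) • u = u := one_smul (Env k A) u
  rw [h1] at h
  rw [pair_apply, rmul_apply, ← h, map_smul, env_smul, one_mul, pair_apply]

theorem pair_balanced (u : U) (a : A) (v : V) :
    pair e (rmul U (op a) u) v = pair e u (lmul V a v) := by
  rw [pair_apply, tmulA_balanced, pair_apply]

/-- The unit is a finite sum of values of the pairing. -/
theorem exists_sum_pair_eq_one : ∃ s : Finset (U × V), ∑ p ∈ s, pair e p.1 p.2 = 1 := by
  obtain ⟨t, ht⟩ := Submodule.mkQ_surjective (tensorRel U V) (e.symm 1)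
  obtain ⟨s, rfl⟩ := TensorProduct.exists_finset t
  refine ⟨s, ?_⟩
  rw [← e.apply_symm_apply 1, ← ht, map_sum]
  exact (map_sum e _ _).symm

/-- Since `1` is a sum of values of the pairing, elements may be compared after multiplication by
such values. -/
theorem lmul_ext_of_pair {W : ModuleCat.{v} (Env k A)} {w w' : W}
    (h : ∀ u v, lmul W (pair e u v) w = lmul W (pair e u v) w') : w = w' := by
  obtain ⟨s, hs⟩ := exists_sum_pair_eq_one e
  rw [← lmul_one w, ← lmul_one w', ← hs, map_sum, LinearMap.sum_apply, LinearMap.sum_apply]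
  exact Finset.sum_congr rfl fun p _ => h p.1 p.2

theorem rmul_ext_of_pair {W : ModuleCat.{v} (Env k A)} {w w' : W}
    (h : ∀ u v, rmul W (op (pair e u v)) w = rmul W (op (pair e u v)) w') : w = w' := by
  obtain ⟨s, hs⟩ := exists_sum_pair_eq_one e
  rw [← rmul_one w, ← rmul_one w', ← hs, rmul_sum, rmul_sum]
  exact Finset.sum_congr rfl fun p _ => h p.1 p.2

end Pair

variable (e : tensorA U V ≃ₗ[Env k A] A) (e' : tensorA V U ≃ₗ[Env k A] A)

/-- The map `v ⊗ u' ↦ (u, v) u'` is right `A`-linear on `V ⊗_A U`. Transported along `e'` to a map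
`A → U`, it is determined by the image `c` of `1`. -/
theorem exists_lmul_pair_eq_rmul (u : U) :
    ∃ c : U, ∀ v u', lmul U (pair e u v) u' = rmul U (op (pair e' v u')) c := by
  let g : tensorA V U →ₗ[k] U := tensorLift ((lmul U).toLinearMap ∘ₗ pair e u) (by
    intro v a u'
    change lmul U (pair e u (rmul V (op a) v)) u' = lmul U (pair e u v) (lmul U a u')
    rw [pair_rmul, lmul_mul])
  have hg : ∀ v u', g (tmulA v u') = lmul U (pair e u v) u' := fun v u' => rfl
  have hlin : ∀ x (a : A), g ((1 ⊗ₜ op a : Env k A) • x) = rmul U (op a) (g x) := by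
    intro x a
    refine tensorA_induction x (fun v u' => ?_) (fun x y hx hy => ?_)
    · have h1 : (1 ⊗ₜ 1 : Env k A) • v = v := one_smul (Env k A) v
      rw [env_smul_tmulA, h1, hg, hg, ← rmul_apply, lmul_rmul]
    · rw [smul_add, map_add, hx, hy, map_add, map_add]
  refine ⟨g (e'.symm 1), fun v u' => ?_⟩
  rw [← hlin, ← hg, ← map_smul, env_smul, one_mul, one_mul, pair_apply, e'.symm_apply_apply]

/-- The mirror image: `u ⊗ v ↦ u (v, u')` is left `A`-linear, and `c` is the image of `1` along `e`.
-/
theorem exists_rmul_pair_eq_lmul (u' : U) :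
    ∃ c : U, ∀ u v, rmul U (op (pair e' v u')) u = lmul U (pair e u v) c := by
  let g : tensorA U V →ₗ[k] U := tensorLift
    ((rmul U).toLinearMap ∘ₗ (opLinearEquiv k).toLinearMap ∘ₗ (pair e').flip u').flip (by
    intro u a v
    change rmul U (op (pair e' v u')) (rmul U (op a) u) = rmul U (op (pair e' (lmul V a v) u')) u
    rw [pair_lmul, rmul_mul])
  have hg : ∀ u v, g (tmulA u v) = rmul U (op (pair e' v u')) u := fun v u' => rfl
  have hlin : ∀ x (a : A), g ((a ⊗ₜ op 1 : Env k A) • x) = lmul U a (g x) := by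
    intro x a
    refine tensorA_induction x (fun u v => ?_) (fun x y hx hy => ?_)
    · have h1 : (1 ⊗ₜ op 1 : Env k A) • v = v := one_smul (Env k A) v
      rw [env_smul_tmulA, h1, hg, hg, ← lmul_apply, lmul_rmul]
    · rw [smul_add, map_add, hx, hy, map_add, map_add]
  refine ⟨g (e.symm 1), fun u v => ?_⟩
  rw [← hlin, ← hg, ← map_smul, env_smul, mul_one, mul_one, pair_apply, e.symm_apply_apply]

/-- Multiplication by a central unit is an automorphism of the bimodule `A`. -/
def centralMul (z z' : A) (hz : ∀ a, a * z = z * a) (h : z * z' = 1) (h' : z' * z = 1) :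
    A ≃ₗ[Env k A] A where
  toFun a := a * z
  invFun a := a * z'
  map_add' a b := add_mul a b z
  map_smul' x a := by
    rw [RingHom.id_apply]
    induction x using TensorProduct.induction_on with
    | zero =>
      exact (congrArg (· * z) (zero_smul (Env k A) a)).trans
        ((zero_mul z).trans (zero_smul (Env k A) (a * z)).symm)
    | tmul b c =>
      obtain ⟨c, rfl⟩ := op_surjective c
      rw [env_smul, env_smul, mul_assoc, hz c]
      simp only [mul_assoc]
    | add x y hx hy => rw [add_smul, add_smul, add_mul, hx, hy]
  left_inv a := by
    change a * z * z' = a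
    rw [mul_assoc, h, mul_one]
  right_inv a := by
    change a * z' * z = a
    rw [mul_assoc, h', mul_one]

/-- The two isomorphisms of an invertible bimodule can be chosen compatibly. -/
theorem IsInvertible.exists_compatible (h : IsInvertible U) :
    ∃ (V : ModuleCat.{v} (Env k A)) (e : tensorA U V ≃ₗ[Env k A] A)
      (e' : tensorA V U ≃ₗ[Env k A] A),
      ∀ u v u', lmul U (pair e u v) u' = rmul U (op (pair e' v u')) u := by
  obtain ⟨V, ⟨e⟩, ⟨e'⟩⟩ := h
  -- `θ` and `η` measure the failure of associativity from the two sides. They commute with both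
  -- actions and are mutually inverse, and such maps of `U` are multiplications by central units.
  choose θ hθ using exists_lmul_pair_eq_rmul e e'
  choose η hη using exists_rmul_pair_eq_lmul e e'
  have hθl : ∀ a u, θ (lmul U a u) = lmul U a (θ u) := fun a u =>
    rmul_ext_of_pair e' fun v u' => by rw [← hθ, pair_lmul, lmul_mul, hθ, lmul_rmul]
  have hθr : ∀ a u, θ (rmul U (op a) u) = rmul U (op a) (θ u) := fun a u =>
    rmul_ext_of_pair e' fun v u' => by
      rw [← hθ, pair_balanced, hθ, pair_lmul, rmul_mul]
  have hηl : ∀ a u, η (lmul U a u) = lmul U a (η u) := fun a u =>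
    lmul_ext_of_pair e fun u' v => by rw [← hη, ← pair_balanced, hη, pair_rmul, lmul_mul]
  have hηr : ∀ a u, η (rmul U (op a) u) = rmul U (op a) (η u) := fun a u =>
    lmul_ext_of_pair e fun u' v => by rw [← hη, pair_rmul, rmul_mul, hη, lmul_rmul]
  have hηadd : ∀ x y, η (x + y) = η x + η y := fun x y =>
    lmul_ext_of_pair e fun u' v => by
      rw [← hη, map_add, rmul_add, hη, hη, map_add]
  have hηθ : ∀ u, η (θ u) = u := fun u =>
    rmul_ext_of_pair e' fun v u' => by rw [← hηr, ← hθ, hηl, ← hη]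
  have hθη : ∀ u, θ (η u) = u := fun u =>
    lmul_ext_of_pair e fun u' v => by rw [← hθl, ← hη, hθr, ← hθ]
  obtain ⟨s, hs⟩ := exists_sum_pair_eq_one e'
  -- The right action on `U` is faithful: `a` is the sum of the values `(x, y a)` of `e'`, where the
  -- values `(x, y)` sum to `1`.
  have hfaith : ∀ a b : A, (∀ u, rmul U (op a) u = rmul U (op b) u) → a = b := by
    intro a b hab
    rw [← one_mul a, ← one_mul b, ← hs, Finset.sum_mul, Finset.sum_mul]
    exact Finset.sum_congr rfl fun p _ => by rw [← pair_rmul, hab, pair_rmul]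
  have hsum : ∀ u, ∑ p ∈ s, lmul U (pair e u p.1) p.2 = θ u := fun u => by
    rw [Finset.sum_congr rfl fun p _ => hθ u p.1 p.2, ← rmul_sum, hs, rmul_one]
  -- Applying `θ` to the second factors of the decomposition of `1` gives the element whose right
  -- multiplication is `θ`; `z'` does the same for `η`.
  let z : A := ∑ p ∈ s, pair e' p.1 (θ p.2)
  let z' : A := ∑ p ∈ s, pair e' p.1 (η p.2)
  have hz : ∀ u, rmul U (op z) u = θ u := fun u => by
    rw [rmul_sum, Finset.sum_congr rfl fun p _ => hη (θ p.2) u p.1]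
    simp only [hηθ, hsum]
  have hz' : ∀ u, rmul U (op z') u = η u := fun u => by
    let η' : U →+ U := AddMonoidHom.mk' η hηadd
    rw [rmul_sum, Finset.sum_congr rfl fun p _ => hη (η p.2) u p.1]
    calc ∑ p ∈ s, lmul U (pair e u p.1) (η (η p.2))
        = ∑ p ∈ s, η' (η' (lmul U (pair e u p.1) p.2)) :=
          Finset.sum_congr rfl fun p _ => by
            change _ = η (η _)
            rw [hηl, hηl]
      _ = η (η (∑ p ∈ s, lmul U (pair e u p.1) p.2)) := by
          rw [← map_sum, ← map_sum]
          rfl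
      _ = η u := by rw [hsum, hηθ]
  have hcent : ∀ a, a * z = z * a := fun a => hfaith _ _ fun u => by
    rw [rmul_mul, rmul_mul, hz, hz, hθr]
  -- The corrected second pairing is `(v, u') z`. As `z` is central, `u (v, u') z = θ(u) (v, u') =
  -- (u, v) u'`.
  refine ⟨V, e, e'.trans (centralMul z z' hcent (hfaith _ _ fun u => ?_)
    (hfaith _ _ fun u => ?_)), fun u v u' => ?_⟩
  · rw [rmul_mul, hz, hz', hηθ, rmul_one]
  · rw [rmul_mul, hz', hz, hθη, rmul_one]
  · change _ = rmul U (op (pair e' v u' * z)) u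
    rw [hcent, rmul_mul, hz, hθ]

end Morita

/-! ### Graded bimodules that are invertible as bimodules -/

section GradedInvertible

open MulOpposite

open scoped ModuleCat.Algebra

variable {k : Type u} [Field k] {A : Type v} [Ring A] [Algebra k A]
variable {G : Type w} [AddCommGroup G] [DecidableEq G]
variable {𝒜 : G → Submodule k A} [GradedAlgebra 𝒜]

theorem lmul_mem (U : GrMod (envGrading 𝒜)) {i j : G} {a : A} (ha : a ∈ 𝒜 i) {u : U.carrier}
    (hu : u ∈ U.deg j) : lmul U.forget a u ∈ U.deg (i + j) :=
  U.smul_mem (Submodule.subset_span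
    ⟨i, 0, a, 1, add_zero i, ha, SetLike.GradedOne.one_mem, rfl⟩) hu

theorem rmul_mem (U : GrMod (envGrading 𝒜)) {i j : G} {a : A} (ha : a ∈ 𝒜 i) {u : U.carrier}
    (hu : u ∈ U.deg j) : rmul U.forget (op a) u ∈ U.deg (j + i) := by
  rw [add_comm]
  exact U.smul_mem (Submodule.subset_span
    ⟨0, i, 1, a, zero_add i, SetLike.GradedOne.one_mem, ha, rfl⟩) hu

/-- The graded left module underlying a graded bimodule. -/
def GrMod.leftModule (U : GrMod (envGrading 𝒜)) : GrMod 𝒜 :=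
  letI := Module.compHom U.carrier
    (Algebra.TensorProduct.includeLeft (R := k) (S := k) (A := A) (B := Aᵐᵒᵖ)).toRingHom
  { carrier := U.carrier
    deg := U.deg
    isInternal := U.isInternal
    smul_mem := fun hr hm => lmul_mem U hr hm }

variable {U : GrMod (envGrading 𝒜)} {V : ModuleCat.{v} (Env k A)}

/-- Pairing with `v` as a homomorphism of left modules. -/
def pairHom (e : tensorA U.forget V ≃ₗ[Env k A] A) (v : V) : U.leftModule.carrier →ₗ[A] A where
  toFun u := pair e (U := U.forget) u v
  map_add' x y := LinearMap.congr_fun (map_add (pair e) (x : U.forget) y) v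
  map_smul' a x := pair_lmul e a (x : U.forget) v

/-- The elements of degree `τ` of the inverse of a graded bimodule. -/
def pairDeg (e : tensorA U.forget V ≃ₗ[Env k A] A) (τ : G) : AddSubgroup V where
  carrier := {v | ∀ σ, ∀ u ∈ U.deg σ, pair e (U := U.forget) u v ∈ 𝒜 (σ + τ)}
  zero_mem' σ u _ := by simp
  add_mem' hx hy σ u hu := by
    rw [map_add]
    exact add_mem (hx σ u hu) (hy σ u hu)
  neg_mem' hx σ u hu := by
    rw [map_neg]
    exact neg_mem (hx σ u hu)

variable (e : tensorA U.forget V ≃ₗ[Env k A] A) (e' : tensorA V U.forget ≃ₗ[Env k A] A)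

-- Nondegeneracy of `e` in its second argument: `(x, u) v = c (u, v)` with `c` depending only on
-- `x`, and the values `(x, u)` generate the unit. Compatibility of the pairings is not required.
include e' in
theorem pair_ext {v v' : V} (h : ∀ u : U.forget, pair e u v = pair e u v') : v = v' :=
  lmul_ext_of_pair e' fun x u => by
    obtain ⟨c, hc⟩ := exists_lmul_pair_eq_rmul e' e x
    rw [hc, hc, h]

/-- The unit is a finite sum of pairings with homogeneous elements. -/
theorem exists_homogeneous_sum_pair_eq_one :
    ∃ (ι : Type (max v w)) (s : Finset ι) (x : ι → V) (y : ι → U.carrier) (σ : ι → G),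
      (∀ j, y j ∈ U.deg (σ j)) ∧ ∑ j ∈ s, pair e' (x j) (U := V) (V := U.forget) (y j) = 1 := by
  obtain ⟨S, hS⟩ := exists_sum_pair_eq_one e'
  choose c hc using U.exists_sum_proj
  refine ⟨Σ _ : V × U.forget, G, S.sigma fun p => c p.2, fun j => j.1.1,
    fun j => U.proj j.2 j.1.2, fun j => j.2, fun j => U.proj_mem _ _, ?_⟩
  rw [Finset.sum_sigma, ← hS]
  refine Finset.sum_congr rfl fun p _ => ?_
  change ∑ i ∈ c p.2, pair e' p.1 (U.proj i p.2) = _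
  rw [← map_sum]
  exact congrArg _ (hc p.2).symm

section Compatible

variable {e e'}
variable (hc : ∀ (u : U.forget) v u', lmul U.forget (pair e u v) u'
  = rmul U.forget (op (pair e' v u')) u)
variable {ι : Type*} {s : Finset ι} {x : ι → V} {y : ι → U.forget} {σ : ι → G}
variable (hy : ∀ j, y j ∈ U.deg (σ j)) (hs : ∑ j ∈ s, pair e' (x j) (y j) = 1)

-- The `y j` with the functionals `(·, x j)` form a finite dual basis of `U` as a left module.
include hc hs in
theorem sum_lmul_pair (u : U.forget) : ∑ j ∈ s, lmul U.forget (pair e u (x j)) (y j) = u := by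
  rw [Finset.sum_congr rfl fun j _ => hc u (x j) (y j), ← rmul_sum, hs, rmul_one]

-- The dual expansion in `V`; it can be tested by pairing with `u`, where it becomes the expansion
-- of `u`.
include hc hs in
theorem sum_rmul_pair (v : V) : ∑ j ∈ s, rmul V (op (pair e (y j) v)) (x j) = v := by
  refine pair_ext e e' fun u => ?_
  conv_rhs => rw [← sum_lmul_pair hc hs u]
  rw [map_sum, map_sum, LinearMap.sum_apply]
  exact Finset.sum_congr rfl fun j _ => by rw [pair_rmul, pair_lmul]

variable (e s x y σ) in
/-- The projection of the inverse of a graded bimodule onto its component of degree `τ`. -/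
def pairProj (τ : G) : V →+ V :=
  AddMonoidHom.mk' (fun v => ∑ j ∈ s,
    rmul V (op ((GrMod.regular 𝒜).proj (σ j + τ) (pair e (y j) v))) (x j)) (fun v v' => by
      simp only [map_add, op_add, LinearMap.add_apply, Finset.sum_add_distrib])

theorem pairProj_apply (τ : G) (v : V) : pairProj e s x y σ τ v = ∑ j ∈ s,
    rmul V (op ((GrMod.regular 𝒜).proj (σ j + τ) (pair e (y j) v))) (x j) := rfl

-- `pairProj` is `homComponent` transported along `V → Hom_A(U, A)`. At `y j` the component takes
-- the value `(y j, v)` cut to degree `σ j + τ`, and left linearity with the dual basis gives the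
-- value at every `u`.
include hc hy hs in
theorem pair_pairProj (τ : G) (v : V) {ρ : G} {u : U.carrier} (hu : u ∈ U.deg ρ) :
    pair e (U := U.forget) u (pairProj e s x y σ τ v)
      = (GrMod.regular 𝒜).proj (ρ + τ) (pair e (U := U.forget) u v) := by
  let f := homComponent (M := U.leftModule) (N := GrMod.regular 𝒜) (pairHom e v) τ
  have hf : ∀ {ρ} {u : U.carrier}, u ∈ U.deg ρ →
      f u = (GrMod.regular 𝒜).proj (ρ + τ) (pair e (U := U.forget) u v) := fun hu =>
    homComponent_of_mem (M := U.leftModule) (N := GrMod.regular 𝒜) (pairHom e v) τ hu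
  rw [← hf hu]
  conv_rhs => rw [← sum_lmul_pair hc hs u]
  refine Eq.trans ?_ (map_sum f _ _).symm
  rw [pairProj_apply, map_sum]
  refine Finset.sum_congr rfl fun j _ => ?_
  rw [pair_rmul, ← hf (hy j)]
  exact (f.map_smul (pair e (U := U.forget) u (x j)) (y j)).symm

include hc hy hs in
theorem pairDeg_isInternal : DirectSum.IsInternal (pairDeg e) := by
  have hext : ∀ v v' : V, (∀ ρ, ∀ u ∈ U.deg ρ, pair e (U := U.forget) u v = pair e u v') →
      v = v' := fun v v' h => pair_ext e e' fun u =>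
    U.homogeneous_induction u h (by
      rw [map_zero]
      rfl) (fun a b ha hb => by
      rw [map_add, LinearMap.add_apply, LinearMap.add_apply, ha, hb])
  refine isInternal_of_proj _ ?_ (pairProj e s x y σ) ?_ ?_
  · rw [eq_top_iff]
    intro v _
    choose c hcs using (GrMod.regular 𝒜).exists_sum_proj_of_subset
    -- Only the degrees `i - σ j`, with `i` among the degrees needed for `(y j, v)`, can contribute
    -- to `v`.
    let t : Finset G := s.biUnion fun j => (c (pair e (y j) v)).image fun i => -σ j + i
    have hv : v = ∑ τ ∈ t, pairProj e s x y σ τ v := by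
      conv_lhs => rw [← sum_rmul_pair hc hs v]
      simp only [pairProj_apply]
      rw [Finset.sum_comm]
      refine Finset.sum_congr rfl fun j hj => ?_
      rw [← rmul_sum]
      have ht : c (pair e (y j) v) ⊆ t.image fun i => σ j + i := by
        intro i hi
        refine Finset.mem_image.2 ⟨-σ j + i, ?_, by simp⟩
        exact Finset.mem_biUnion.2 ⟨j, hj, Finset.mem_image.2 ⟨i, hi, rfl⟩⟩
      have h := hcs _ _ ht
      rw [Finset.sum_image (fun x _ y _ h => add_left_cancel h)] at h
      rw [← h]
    rw [hv]
    refine sum_mem fun τ _ => AddSubgroup.mem_iSup_of_mem τ fun ρ u hu => ?_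
    rw [pair_pairProj hc hy hs τ v hu]
    exact (GrMod.regular 𝒜).proj_mem _ _
  · intro τ v hv
    refine hext _ _ fun ρ u hu => ?_
    rw [pair_pairProj hc hy hs τ v hu]
    exact (GrMod.regular 𝒜).proj_same _ _ (hv ρ u hu)
  · intro τ τ' h v hv
    refine hext _ _ fun ρ u hu => ?_
    rw [pair_pairProj hc hy hs τ v hu, map_zero]
    exact (GrMod.regular 𝒜).proj_ne _ (ρ + τ') (by simpa using h) _ (hv ρ u hu)

/-- The second pairing is homogeneous as well. -/
theorem pair_symm_mem (hc : ∀ (u : U.forget) v u', lmul U.forget (pair e u v) u'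
      = rmul U.forget (op (pair e' v u')) u) {τ ρ : G} {v : V} (hv : v ∈ pairDeg e τ)
    {u : U.carrier} (hu : u ∈ U.deg ρ) : pair e' v (V := U.forget) u ∈ 𝒜 (τ + ρ) := by
  obtain ⟨S, hS⟩ := exists_sum_pair_eq_one e'
  -- For `w` of degree `ι`, compatibility gives `w (v, u) = (w, v) u`, of degree `ι + τ + ρ`. Hence
  -- the components of `(v, u)` in other degrees annihilate `U` from the right, and the right action
  -- is faithful.
  have hzero : ∀ δ, δ ≠ τ + ρ →
      (GrMod.regular 𝒜).proj δ (pair e' v (V := U.forget) u) = 0 := by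
    intro δ hδ
    set b := pair e' v (V := U.forget) u with hb
    have hann : ∀ w : U.forget, rmul U.forget (op ((GrMod.regular 𝒜).proj δ b)) w = 0 := by
      intro w
      refine U.homogeneous_induction w (fun ι w hw => ?_) (map_zero _) (fun x y hx hy => ?_)
      · have h1 : rmul U.forget (op b) w ∈ U.deg (ι + (τ + ρ)) := by
          rw [hb, ← hc, ← add_assoc]
          exact lmul_mem U (hv ι w hw) hu
        have h2 : ∀ a : A, rmul U.forget (op ((GrMod.regular 𝒜).proj δ a)) w
            = U.proj (ι + δ) (rmul U.forget (op a) w) := by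
          intro a
          refine (GrMod.regular 𝒜).homogeneous_induction a (fun i a ha => ?_) ?_
            (fun x y hx hy => ?_)
          · have hm := rmul_mem U ha hw
            by_cases h : i = δ
            · subst h
              rw [(GrMod.regular 𝒜).proj_same _ _ ha]
              exact (U.proj_same _ _ hm).symm
            · rw [(GrMod.regular 𝒜).proj_ne _ _ h _ ha]
              refine Eq.trans ?_ (U.proj_ne _ (ι + i) (by simpa using h) _ hm).symm
              simp
          · simp
          · rw [map_add, rmul_add, rmul_add, hx, hy]
            exact (map_add _ _ _).symm
        rw [h2]
        exact U.proj_ne _ _ (by simpa using hδ.symm) _ h1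
      · rw [map_add, hx, hy, add_zero]
    rw [← one_mul ((GrMod.regular 𝒜).proj δ b), ← hS, Finset.sum_mul]
    exact Finset.sum_eq_zero fun p _ => by rw [← pair_rmul, hann, map_zero]
  obtain ⟨t, ht⟩ := (GrMod.regular 𝒜).exists_sum_proj_of_subset (pair e' v (V := U.forget) u)
  have h := ht (insert (τ + ρ) t) (Finset.subset_insert _ _)
  rw [Finset.sum_eq_single (τ + ρ) (fun δ _ hδ => hzero δ hδ)
    (fun h => absurd (Finset.mem_insert_self _ _) h)] at h
  rw [h]
  exact (GrMod.regular 𝒜).proj_mem _ _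

end Compatible

/-- A homogeneous isomorphism `U ⊗_A V ≃ A` identifies the gradings. -/
theorem mem_tensorDeg_iff {U V : GrMod (envGrading 𝒜)}
    (e : tensorA U.forget V.forget ≃ₗ[Env k A] A)
    (he : ∀ i j, ∀ u ∈ U.deg i, ∀ v ∈ V.deg j,
      pair e (U := U.forget) (V := V.forget) u v ∈ 𝒜 (i + j)) (γ : G)
    (x : tensorA U.forget V.forget) : x ∈ tensorDeg U V γ ↔ e x ∈ 𝒜 γ := by
  constructor
  · intro hx
    induction hx using AddSubgroup.closure_induction with
    | mem x hx =>
      obtain ⟨i, j, u, v, rfl, hu, hv, rfl⟩ := hx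
      exact he i j u hu v hv
    | zero => rw [map_zero]; exact zero_mem _
    | add x y _ _ hx hy => rw [map_add]; exact add_mem hx hy
    | neg x _ hx => rw [map_neg]; exact neg_mem hx
  · intro hx
    -- Cutting `e x` to degree `γ` can be tested on tensors of homogeneous elements, where it keeps
    -- or kills the tensor. An `x` with `e x` of degree `γ` is unchanged by it.
    have key : ∀ x, e.symm ((GrMod.regular 𝒜).proj γ (e x)) ∈ tensorDeg U V γ := by
      intro x
      refine tensorA_induction x (fun u v => ?_) (fun x y hx hy => ?_)
      · refine U.homogeneous_induction u (fun i u hu => ?_) ?_ (fun u u' h h' => ?_)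
        · refine V.homogeneous_induction v (fun j v hv => ?_) ?_ (fun v v' h h' => ?_)
          · have hm := he i j u hu v hv
            by_cases h : i + j = γ
            · have := (GrMod.regular 𝒜).proj_same _ _ (h ▸ hm)
              rw [pair_apply] at this
              rw [this, e.symm_apply_apply]
              exact AddSubgroup.subset_closure ⟨i, j, u, v, h, hu, hv, rfl⟩
            · have := (GrMod.regular 𝒜).proj_ne _ _ h _ hm
              rw [pair_apply] at this
              rw [this, map_zero]
              exact zero_mem _
          · have : tmulA (U := U.forget) (V := V.forget) u 0 = 0 :=
              e.injective (by rw [← pair_apply, map_zero, map_zero])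
            rw [this, map_zero, map_zero, map_zero]
            exact zero_mem _
          · have : tmulA (U := U.forget) (V := V.forget) u (v + v') = tmulA u v + tmulA u v' :=
              tmulA_add_right _ _ _
            rw [this, map_add, map_add, map_add]
            exact add_mem h h'
        · have : tmulA (U := U.forget) (V := V.forget) 0 v = 0 :=
            e.injective (by rw [← pair_apply, map_zero, map_zero]; rfl)
          rw [this, map_zero, map_zero, map_zero]
          exact zero_mem _
        · have : tmulA (U := U.forget) (V := V.forget) (u + u') v = tmulA u v + tmulA u' v :=
            tmulA_add_left _ _ _
          rw [this, map_add, map_add, map_add]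
          exact add_mem h h'
      · rw [map_add, map_add, map_add]
        exact add_mem hx hy
    have h := key x
    rwa [(GrMod.regular 𝒜).proj_same _ _ hx, e.symm_apply_apply] at h

/-- A graded bimodule that is invertible as a bimodule is graded invertible. -/
theorem isGrInvertible_of_isInvertible (U : GrMod (envGrading 𝒜)) (h : IsInvertible U.forget) :
    IsGrInvertible U := by
  obtain ⟨V, e, e', hc⟩ := h.exists_compatible
  obtain ⟨ι, s, x, y, σ, hy, hs⟩ := exists_homogeneous_sum_pair_eq_one e'
  let W : GrMod (envGrading 𝒜) :=
    { carrier := V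
      deg := pairDeg e
      isInternal := pairDeg_isInternal hc hy hs
      smul_mem := by
        intro i j r m hr hm
        induction hr using Submodule.span_induction with
        | mem r hr =>
          obtain ⟨i, i', a, b, rfl, ha, hb, rfl⟩ := hr
          intro ρ u hu
          -- The identity `(u, a v b) = (u a, v) b` reduces the degree of `a v b` to that of `v`.
          rw [tmul_smul_eq, ← pair_balanced, pair_rmul]
          have := SetLike.GradedMul.mul_mem (hm _ _ (rmul_mem U ha hu)) hb
          rwa [show ρ + i + j + i' = ρ + (i + i' + j) by abel] at this
        | zero =>
          have h0 : (0 : Env k A) • (m : V) = 0 := zero_smul (Env k A) (m : V)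
          rw [h0]
          exact zero_mem _
        | add x y _ _ hx hy => rw [add_smul]; exact add_mem hx hy
        | smul c x _ hx =>
          intro ρ u hu
          have hcx : (c • x) • (m : V) = c • (x • (m : V)) := smul_assoc c x (m : V)
          rw [hcx, map_smul]
          exact Submodule.smul_mem _ c (hx ρ u hu) }
  refine ⟨W, ⟨e, mem_tensorDeg_iff (U := U) (V := W) e fun i j u hu v hv => hv i u hu⟩,
    ⟨e', mem_tensorDeg_iff (U := W) (V := U) e' fun i j v hv u hu => pair_symm_mem hc hv hu⟩⟩

end GradedInvertible

/-! ### Comparison of graded and ungraded twisted Calabi–Yau algebras -/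

section Main

open MulOpposite CategoryTheory

/-- Direct sum decompositions are preserved by additive equivalences. -/
theorem isInternal_map {G : Type w} [AddCommGroup G] [DecidableEq G] {M N : Type v}
    [AddCommGroup M] [AddCommGroup N] {deg : G → AddSubgroup M} (h : DirectSum.IsInternal deg)
    (e : M ≃+ N) : DirectSum.IsInternal fun i => (deg i).map e.toAddMonoidHom := by
  classical
  let _ := h.chooseDecomposition
  refine isInternal_of_proj _ ?_ (fun i => e.toAddMonoidHom.comp (((deg i).subtype.comp
    ((DFinsupp.evalAddMonoidHom i).comp (DirectSum.decomposeAddEquiv deg).toAddMonoidHom)).comp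
      e.symm.toAddMonoidHom)) ?_ ?_
  · rw [eq_top_iff]
    intro x _
    rw [← e.apply_symm_apply x, ← DirectSum.sum_support_decompose deg (e.symm x), map_sum]
    exact sum_mem fun i _ => AddSubgroup.mem_iSup_of_mem i ⟨_, SetLike.coe_mem _, rfl⟩
  · rintro i _ ⟨x, hx, rfl⟩
    change e ((DirectSum.decompose deg (e.symm (e x)) i : M)) = e x
    rw [e.symm_apply_apply, DirectSum.decompose_of_mem_same deg hx]
  · rintro i j hij _ ⟨x, hx, rfl⟩
    change e ((DirectSum.decompose deg (e.symm (e x)) i : M)) = 0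
    rw [e.symm_apply_apply, DirectSum.decompose_of_mem_ne deg hx hij, map_zero]

variable {k : Type u} [Field k] {A : Type v} [Ring A] [Algebra k A]
variable {G : Type w} [AddCommGroup G] [DecidableEq G]
variable (𝒜 : G → Submodule k A) [GradedAlgebra 𝒜]

/-- From left to right the graded resolution is built anew, only its length being controlled by the
given one; from right to left the grading is forgotten. -/
theorem isHomologicallySmooth_iff : IsHomologicallySmooth k A ↔ IsGrHomologicallySmooth 𝒜 := by
  constructor
  · rintro ⟨P, hP, N, hN⟩
    exact exists_finite_grProjRes (M := grSelf 𝒜)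
      (hasFiniteResolution_of_projectiveResolution P hP hN)
  · rintro ⟨P, hP, N, hN⟩
    refine ⟨P.toProjectiveResolution, hP, N, fun n hn => ?_⟩
    have := hN n hn
    exact ModuleCat.isZero_of_subsingleton (ModuleCat.of (Env k A) (P.X n).carrier)

variable {𝒜}

/-- Over a graded homologically smooth algebra, graded and ungraded `Ext` agree. -/
theorem IsGrHomologicallySmooth.exists_grExt_equiv (h : IsGrHomologicallySmooth 𝒜) (n : ℕ) :
    Nonempty (grExt (grSelf 𝒜) n ≃ₗ[(Env k A)ᵐᵒᵖ] ExtR (ModuleCat.of (Env k A) A) n) := by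
  obtain ⟨P, hP, -⟩ := h
  -- The resolution chosen in `grExt` need not be finitely generated, so it is compared with `P`,
  -- for which HOM is Hom.
  obtain ⟨e, -⟩ := (Classical.choice (GrProjRes.exists (grSelf 𝒜))).exists_cohomology_equiv P n
  obtain ⟨e'⟩ := P.exists_cohomology_equiv_ext hP n
  exact ⟨e.trans e'⟩

/-- The grading of a bimodule identified with the cohomology of a graded resolution. -/
def cohomologyGrMod {M : GrMod (envGrading 𝒜)} (P : GrProjRes M) {n : ℕ}
    {U : ModuleCat.{v} (Env k A)} (φ : P.cohomology n ≃+ U)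
    (hφ : ∀ (a b : A) (x : P.cohomology n),
      φ (op (b ⊗ₜ op a : Env k A) • x) = (a ⊗ₜ op b : Env k A) • φ x) :
    GrMod (envGrading 𝒜) where
  carrier := U
  deg γ := (P.cohomologyDeg n γ).map φ.toAddMonoidHom
  isInternal := isInternal_map (P.cohomology_isInternal n) φ
  smul_mem := by
    -- The right action of `b ⊗ op a` becomes the left action of `a ⊗ op b`; both have degree `i +
    -- j` because `G` is commutative.
    have gen : ∀ {i j l : G} {a b : A} {m : U}, a ∈ 𝒜 i → b ∈ 𝒜 j →
        m ∈ (P.cohomologyDeg n l).map φ.toAddMonoidHom → (a ⊗ₜ op b : Env k A) • m ∈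
          (P.cohomologyDeg n (i + j + l)).map φ.toAddMonoidHom := by
      rintro i j l a b _ ha hb ⟨x, hx, rfl⟩
      refine ⟨op (b ⊗ₜ op a : Env k A) • x, ?_, hφ a b x⟩
      rw [add_comm]
      exact P.smul_mem_cohomologyDeg n
        (𝓡 := envGrading 𝒜) (Submodule.subset_span ⟨j, i, b, a, add_comm j i, hb, ha, rfl⟩) hx
    intro i j r m hr hm
    induction hr using Submodule.span_induction with
    | mem r hr =>
      obtain ⟨i, i', a, b, rfl, ha, hb, rfl⟩ := hr
      exact gen ha hb hm
    | zero =>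
      have h0 : (0 : Env k A) • m = 0 := zero_smul (Env k A) m
      rw [h0]
      exact zero_mem _
    | add x y _ _ hx hy => rw [add_smul]; exact add_mem hx hy
    | smul c x _ hx =>
      -- The components are only known to be additive subgroups, so a scalar `c` is treated as the
      -- degree zero element `c ⊗ 1`.
      have hcx : (c • x) • m = (algebraMap k A c ⊗ₜ op 1 : Env k A) • (x • m) := by
        rw [smul_smul]
        exact congrArg (· • m) (Algebra.smul_def c x)
      have := gen (SetLike.algebraMap_mem_graded 𝒜 c) (SetLike.GradedOne.one_mem (A := 𝒜)) hx
      rwa [add_zero, zero_add, ← hcx] at this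

/-- From left to right, `U` receives the grading of `grExt` by transport, so compatibility of the
isomorphism with degrees is automatic and graded invertibility is the remaining point. -/
theorem isTwistedCY_iff_isGrTwistedCY (d : ℕ) : IsTwistedCY k A d ↔ IsGrTwistedCY 𝒜 d := by
  constructor
  · rintro ⟨hs, U, hU, hne, φ, hφ⟩
    have hs := (isHomologicallySmooth_iff 𝒜).1 hs
    have E := fun n => (hs.exists_grExt_equiv n).some
    have hψ : ∀ (a b : A) (x : grExt (grSelf 𝒜) d),
        ((E d).toAddEquiv.trans φ) (op (b ⊗ₜ op a : Env k A) • x)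
          = (a ⊗ₜ op b : Env k A) • ((E d).toAddEquiv.trans φ) x := fun a b x => by
      change φ (E d _) = _ • φ (E d x)
      rw [map_smul, hφ]
    refine ⟨hs, cohomologyGrMod _ ((E d).toAddEquiv.trans φ) hψ, isGrInvertible_of_isInvertible _ hU,
      fun i hi => ?_, (E d).toAddEquiv.trans φ, hψ, fun γ x => ?_⟩
    · have := hne i hi
      exact (E i).injective.subsingleton
    · refine ⟨fun hx => ⟨x, hx, rfl⟩, ?_⟩
      rintro ⟨y, hy, hyx⟩
      rwa [← ((E d).toAddEquiv.trans φ).injective hyx]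
  · rintro ⟨hs, U, ⟨V, ⟨e, -⟩, ⟨e', -⟩⟩, hne, φ, hφ, -⟩
    have E := fun n => (hs.exists_grExt_equiv n).some
    refine ⟨(isHomologicallySmooth_iff 𝒜).2 hs, U.forget, ⟨V.forget, ⟨e⟩, ⟨e'⟩⟩,
      fun i hi => ?_, (E d).symm.toAddEquiv.trans φ, fun a b x => ?_⟩
    · have := hne i hi
      exact (E i).symm.injective.subsingleton
    · change φ ((E d).symm _) = _ • φ ((E d).symm x)
      rw [map_smul, hφ]

end Main

end GradedCY

end

theorem theorem3p2 {k : Type u} [Field k] {A : Type v} [Ring A] [Algebra k A]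
    {G : Type w} [AddCommGroup G] [DecidableEq G]
    (𝒜 : G → Submodule k A) [GradedAlgebra 𝒜] (d : ℕ) :
    GradedCY.IsTwistedCY k A d ↔ GradedCY.IsGrTwistedCY 𝒜 d :=
  GradedCY.isTwistedCY_iff_isGrTwistedCY d
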